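/- Write $\log x$ for $\log(\max\{e,x\})$. Let $P$ be a probability measure on a measurable space $(\mathcal X,\mathcal A)$, let $X_1,\dots,X_n$ ($n\ge 1$) be i.i.d. with law $P$, and let $\mathscr C\subset\mathcal A$ be a countable class of sets. For $C\in\mathscr C$ put $\mathbb G_n(C)=\sqrt n\,\big(\frac1n\sum_{i=1}^n \mathbf 1_C(X_i)-P(C)\big)$, and for $\sigma>0$ let $\mathscr C(\sigma)=\{C\in\mathscr C: P(C)\le\sigma^2\}$. Let $\mathcal N_I(\epsilon,\mathscr C,P)$ be the minimal number of brackets $[\ell,u]=\{f:\ell\le f\le u\}$, with $\ell,u\in L_1(P)$ and $\|u-\ell\|_{L_1(P)}<\epsilon$, needed to cover $\{\mathbf 1_C:C\in\mathscr C\}$. For a class $\mathscr D\subset\mathcal A$ let $\mathcal N(\epsilon,\mathscr D,P)$ be the minimal number of balls $\{C\in\mathscr D: P(C\,\triangle\, D)<\epsilon\}$, $D\in\mathscr D$, needed to cover $\mathscr D$. For $\alpha>0$ and $L>0$ consider the conditions, for all $0<\epsilon\le 1$: (E1) $\log\mathcal N_I(\epsilon,\mathscr C,P)\le L\epsilon^{-\alpha}$;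 (E2) $\log\mathcal N(\epsilon/4,\mathscr C(\sqrt\epsilon),P)\ge L^{-1}\epsilon^{-\alpha}$. Theorem. Let $\alpha>0$, $\alpha\ne1$, $L>0$ and $c>0$. There is a constant $K>0$ depending only on $\alpha,L,c$ such that, for all $P$, $\mathscr C$ satisfying (E1), all $n\ge1$ and all $\sigma>0$ with $\sigma^2\ge c\,n^{-1/(\alpha+1)}$, $$\mathbb E\sup_{C\in\mathscr C(\sigma)}|\mathbb G_n(C)|\le K\max\big\{\sigma^{1-\alpha},\,n^{(\alpha-1)/(2(\alpha+1))}\big\}.$$ If furthermore (E2) holds and $\sigma\le1$, then $$\mathbb E\sup_{C\in\mathscr C(\sigma)}|\mathbb G_n(C)|\ge K^{-1}\max\big\{\sigma^{1-\alpha},\,n^{(\alpha-1)/(2(\alpha+1))}\big\}.$$ -/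

import Mathlib

open MeasureTheory ProbabilityTheory
open scoped ENNReal

universe u v

namespace SetEP

/-- The convention `log x ≡ log (e ∨ x)`, for a count that may be infinite. -/
noncomputable def logE (N : ℕ∞) : EReal :=
  ENNReal.log (max (ENNReal.ofReal (Real.exp 1)) (N : ℝ≥0∞))

/-- The bracketing number `N_[](ε, F, L₁(P))`: the least number of brackets `[l, u]` with
`l, u` in `L₁(P)` and `‖u - l‖_{L₁(P)} < ε` that cover `F` (`⊤` if no finite family does).
A bracket `[l, u] = {f : l ≤ f ≤ u}` is represented by the pair `(l, u)`. -/
noncomputable def bracketingNumber {𝒳 : Type u} [MeasurableSpace 𝒳] (P : Measure 𝒳)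
    (ε : ℝ) (F : Set (𝒳 → ℝ)) : ℕ∞ :=
  ⨅ (s : Finset ((𝒳 → ℝ) × (𝒳 → ℝ)))
    (_ : (∀ b ∈ s, Measurable b.1 ∧ Integrable b.1 P ∧ Measurable b.2 ∧ Integrable b.2 P ∧
            eLpNorm (b.2 - b.1) 1 P < ENNReal.ofReal ε) ∧
          ∀ f ∈ F, ∃ b ∈ s, b.1 ≤ f ∧ f ≤ b.2),
    (s.card : ℕ∞)

/-- The covering number `N(ε, F, L₁(P))`: the least number of open `L₁(P)`-balls of radius `ε`
in `F` (that is, centred at elements of `F`) that cover `F` (`⊤` if no finite family does). -/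
noncomputable def coveringNumber {𝒳 : Type u} [MeasurableSpace 𝒳] (P : Measure 𝒳)
    (ε : ℝ) (F : Set (𝒳 → ℝ)) : ℕ∞ :=
  ⨅ (s : Finset (𝒳 → ℝ))
    (_ : (∀ g ∈ s, g ∈ F) ∧ ∀ f ∈ F, ∃ g ∈ s, eLpNorm (f - g) 1 P < ENNReal.ofReal ε),
    (s.card : ℕ∞)

/-- The indicator function `1_C`. -/
noncomputable def ind {𝒳 : Type u} (C : Set 𝒳) : 𝒳 → ℝ := C.indicator (fun _ => 1)

/-- `𝒞(σ) = {C ∈ 𝒞 : P(C) ≤ σ²}`. -/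
def localClass {𝒳 : Type u} [MeasurableSpace 𝒳] (P : Measure 𝒳) (𝒞 : Set (Set 𝒳)) (σ : ℝ) :
    Set (Set 𝒳) :=
  {C | C ∈ 𝒞 ∧ P C ≤ ENNReal.ofReal (σ ^ 2)}

/-- Upper entropy condition: `log N_I(ε, 𝒞, P) ≤ L ε^{-α}`, where
`N_I(ε, 𝒞, P) = N_[](ε, 1_𝒞, L₁(P))`. -/
def E1 {𝒳 : Type u} [MeasurableSpace 𝒳] (P : Measure 𝒳) (𝒞 : Set (Set 𝒳)) (α L : ℝ) : Prop :=
  ∀ ε : ℝ, 0 < ε → ε ≤ 1 →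
    logE (bracketingNumber P ε (ind '' 𝒞)) ≤ ((L * ε ^ (-α) : ℝ) : EReal)

/-- Lower entropy condition: `log N(ε/4, 𝒞(√ε), P) ≥ L⁻¹ ε^{-α}`. -/
def E2 {𝒳 : Type u} [MeasurableSpace 𝒳] (P : Measure 𝒳) (𝒞 : Set (Set 𝒳)) (α L : ℝ) : Prop :=
  ∀ ε : ℝ, 0 < ε → ε ≤ 1 →
    ((L⁻¹ * ε ^ (-α) : ℝ) : EReal) ≤
      logE (coveringNumber P (ε / 4) (ind '' localClass P 𝒞 (Real.sqrt ε)))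

/-- The empirical process `𝔾ₙ(f) = √n (ℙₙ f - P f)` of the sample `x₁, …, xₙ`. -/
noncomputable def empG {𝒳 : Type u} [MeasurableSpace 𝒳] (P : Measure 𝒳) {n : ℕ}
    (x : Fin n → 𝒳) (f : 𝒳 → ℝ) : ℝ :=
  Real.sqrt n * ((n : ℝ)⁻¹ * ∑ i, f (x i) - ∫ y, f y ∂P)

/-- `𝔼 sup_{C ∈ 𝒟} |𝔾ₙ(C)|` for the random sample `X₁, …, Xₙ` on `(Ω, μ)`. -/
noncomputable def expectedSup {𝒳 : Type u} [MeasurableSpace 𝒳] (P : Measure 𝒳)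
    {Ω : Type v} [MeasurableSpace Ω] (μ : Measure Ω) {n : ℕ} (X : Fin n → Ω → 𝒳)
    (𝒟 : Set (Set 𝒳)) : ℝ≥0∞ :=
  ∫⁻ ω, ⨆ C ∈ 𝒟, ENNReal.ofReal |empG P (fun i => X i ω) (ind C)| ∂μ

end SetEP

/-! Write τ = n^(-1/(α+1)), the scale at which √n·τ = τ^((1-α)/2). A scale ε above τ contains about
exp(ε^(-α)) sets of measure about ε, and contributes ε^((1-α)/2), as it would for a Gaussian
process. As α ≠ 1, this power is strictly monotone in ε, so the largest contribution comes from one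
of the end scales σ² and τ. This is the maximum in the theorem.

Upper bound (`expectedSup_le_chaining`): chain along the lower ends of brackets at dyadic scales
from max(σ², τ), capped at 1, down to τ. Above τ a Bernstein bound is still in its Gaussian range
(`lintegral_iSup_empG_le_rpow`), and the scales sum geometrically. At τ the remainder is dominated
by a bracket width, whose mean costs √n·τ = τ^((1-α)/2), so no truncation is needed.

Lower bound (`le_integral_norm_sum_indVec_sub`): (E2) gives a packing C_j of exponentially many sets
of measure at most ε. For I ⊆ {1,…,n}, tilt the law of the observations in I by 1 + δ h_j and of the
others by 1 - δ h_j, where h_j = 1_{C_j} - P(C_j). These densities average to 1 over all I, so the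
averaged tilted expectation is the original one. For fixed I, Jensen replaces the observations
outside I by their tilted mean. The sum over I is then compared with centres θ_j that are separated
in sup norm, and it can be close to at most one of them. The likelihood ratios have second moment at
most exp(nδ²ε), at most a quarter of the number of sets, so the exceptional centre carries little
weight. -/

namespace SetEP

/-! ### Independence, Jensen and product changes of measure -/

section Independence

variable {Ω : Type v} [MeasurableSpace Ω] {μ : Measure Ω} [IsProbabilityMeasure μ]

/-- A conditional form of Jensen's inequality: if `(Z, R)` and `(Y, R')` are independent, the
weights are nonnegative and `R'` has mean one, then replacing `Y` by its `R'`-weighted mean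
decreases the weighted mean norm of `Z + Y`. -/
lemma integral_norm_add_integral_mul_le {E : Type*} [NormedAddCommGroup E] [NormedSpace ℝ E]
    [MeasurableSpace E] [BorelSpace E] [SecondCountableTopology E] [CompleteSpace E]
    {Z Y : Ω → E} {R R' : Ω → ℝ} (hZ : Measurable Z) (hY : Measurable Y) (hR : Measurable R)
    (hR' : Measurable R') (hind : IndepFun (fun ω => (Z ω, R ω)) (fun ω => (Y ω, R' ω)) μ)
    {B : ℝ} (hZB : ∀ ω, ‖Z ω‖ ≤ B) (hYB : ∀ ω, ‖Y ω‖ ≤ B) (hR0 : ∀ ω, 0 ≤ R ω)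
    (hR'0 : ∀ ω, 0 ≤ R' ω) (hRB : ∀ ω, R ω ≤ B) (hR'B : ∀ ω, R' ω ≤ B)
    (hR'1 : ∫ ω, R' ω ∂μ = 1) :
    ∫ ω, ‖Z ω + ∫ ω', R' ω' • Y ω' ∂μ‖ * R ω ∂μ ≤ ∫ ω, ‖Z ω + Y ω‖ * (R ω * R' ω) ∂μ := by
  have hB : 0 ≤ B := by
    obtain ⟨ω⟩ : Nonempty Ω := by
      by_contra h
      rw [not_nonempty_iff] at h
      have := hR'1
      simp [integral_of_isEmpty] at this
    exact (norm_nonneg _).trans (hZB ω)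
  have hint : Integrable (fun p : Ω × Ω => ‖Z p.1 + Y p.2‖ * (R p.1 * R' p.2)) (μ.prod μ) := by
    refine Integrable.of_bound (by fun_prop) ((B + B) * (B * B)) (ae_of_all _ fun p => ?_)
    have h1 : ‖Z p.1 + Y p.2‖ ≤ B + B := (norm_add_le _ _).trans (add_le_add (hZB _) (hYB _))
    have h2 : R p.1 * R' p.2 ≤ B * B := mul_le_mul (hRB _) (hR'B _) (hR'0 _) hB
    rw [Real.norm_of_nonneg (mul_nonneg (norm_nonneg _) (mul_nonneg (hR0 _) (hR'0 _)))]
    exact mul_le_mul h1 h2 (mul_nonneg (hR0 _) (hR'0 _)) (by linarith)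
  -- By independence `(Y, R')` may be evaluated at an independent copy of `ω`; Jensen then applies
  -- with the first coordinate fixed.
  have key : ∫ ω, ‖Z ω + Y ω‖ * (R ω * R' ω) ∂μ =
      ∫ p, ‖Z p.1 + Y p.2‖ * (R p.1 * R' p.2) ∂(μ.prod μ) := by
    have hmap := hind.map_prod_eq_prod_map_map (by fun_prop) (by fun_prop)
    rw [Measure.map_prod_map _ _ (by fun_prop) (by fun_prop)] at hmap
    have hφ : Measurable fun q : (E × ℝ) × (E × ℝ) => ‖q.1.1 + q.2.1‖ * (q.1.2 * q.2.2) := by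
      fun_prop
    have h1 := integral_map (μ := μ) (φ := fun ω => ((Z ω, R ω), (Y ω, R' ω)))
      (by fun_prop) hφ.aestronglyMeasurable
    have h2 := integral_map (μ := μ.prod μ)
      (φ := Prod.map (fun ω => (Z ω, R ω)) (fun ω => (Y ω, R' ω)))
      (by fun_prop) hφ.aestronglyMeasurable
    rw [← hmap, h1] at h2
    simpa using h2
  have hiR' : Integrable R' μ := Integrable.of_bound (by fun_prop) B
    (ae_of_all _ fun ω => by rw [Real.norm_of_nonneg (hR'0 ω)]; exact hR'B ω)
  have hiY : Integrable (fun ω => R' ω • Y ω) μ :=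
    Integrable.of_bound (by fun_prop) (B * B) (ae_of_all _ fun ω => by
      rw [norm_smul, Real.norm_of_nonneg (hR'0 ω)]
      exact mul_le_mul (hR'B ω) (hYB ω) (norm_nonneg _) hB)
  rw [key, integral_prod _ hint]
  refine integral_mono_of_nonneg (ae_of_all _ fun ω => mul_nonneg (norm_nonneg _) (hR0 ω))
    hint.integral_prod_left (ae_of_all _ fun ω => ?_)
  have h3 : Z ω + ∫ ω', R' ω' • Y ω' ∂μ = ∫ ω', R' ω' • (Z ω + Y ω') ∂μ := by
    simp_rw [smul_add]
    rw [integral_add (hiR'.smul_const _) hiY, integral_smul_const, hR'1, one_smul]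
  calc ‖Z ω + ∫ ω', R' ω' • Y ω' ∂μ‖ * R ω
      ≤ (∫ ω', ‖R' ω' • (Z ω + Y ω')‖ ∂μ) * R ω := by
        rw [h3]; exact mul_le_mul_of_nonneg_right (norm_integral_le_integral_norm _) (hR0 ω)
    _ = ∫ ω', ‖Z ω + Y ω'‖ * (R ω * R' ω') ∂μ := by
        rw [← integral_mul_const]
        congr 1 with ω'
        rw [norm_smul, Real.norm_of_nonneg (hR'0 ω')]
        ring

variable {𝒳 : Type u} [MeasurableSpace 𝒳] {P : Measure 𝒳} {n : ℕ} {X : Fin n → Ω → 𝒳}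

lemma integral_comp_of_map_eq {Ω : Type v} [MeasurableSpace Ω] {μ : Measure Ω} {𝒳 : Type u}
    [MeasurableSpace 𝒳] {P : Measure 𝒳} {Y : Ω → 𝒳} (hY : Measurable Y) (hYP : μ.map Y = P)
    {f : 𝒳 → ℝ} (hf : Measurable f) : ∫ ω, f (Y ω) ∂μ = ∫ x, f x ∂P := by
  rw [← hYP, integral_map hY.aemeasurable hf.aestronglyMeasurable]

lemma integral_finset_prod_comp (hX : ∀ i, Measurable (X i)) (hind : iIndepFun X μ)
    (hP : ∀ i, μ.map (X i) = P) {f : Fin n → 𝒳 → ℝ} (hf : ∀ i, Measurable (f i))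
    (T : Finset (Fin n)) :
    ∫ ω, ∏ i ∈ T, f i (X i ω) ∂μ = ∏ i ∈ T, ∫ x, f i x ∂P := by
  classical
  have h := hind.integral_fun_prod_comp (f := fun i x => if i ∈ T then f i x else 1)
    (fun i => (hX i).aemeasurable) (fun i => by
      by_cases hi : i ∈ T
      · simpa [hi] using (hf i).aestronglyMeasurable
      · simpa [hi] using aestronglyMeasurable_const)
  have e1 : ∀ ω, ∏ i ∈ T, f i (X i ω) = ∏ i, if i ∈ T then f i (X i ω) else 1 := fun ω => by
    simp [Finset.prod_ite_mem]
  have e2 : ∏ i ∈ T, ∫ x, f i x ∂P = ∏ i, if i ∈ T then ∫ x, f i x ∂P else 1 := by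
    simp [Finset.prod_ite_mem]
  simp_rw [e1, e2]
  rw [h]
  refine Finset.prod_congr rfl fun i _ => ?_
  by_cases hi : i ∈ T
  · simp [hi, integral_comp_of_map_eq (hX i) (hP i) (hf i)]
  · simp [hi]

/-- The mean of a sum over an i.i.d. sample under a product change of measure. -/
lemma integral_sum_mul_prod_comp (hX : ∀ i, Measurable (X i)) (hind : iIndepFun X μ)
    (hP : ∀ i, μ.map (X i) = P) {f g : 𝒳 → ℝ} (hf : Measurable f) (hg : Measurable g)
    {B : ℝ} (hfB : ∀ x, |f x| ≤ B) (hgB : ∀ x, |g x| ≤ B) (hg1 : ∫ x, g x ∂P = 1)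
    (T : Finset (Fin n)) :
    ∫ ω, (∏ i ∈ T, g (X i ω)) * ∑ i ∈ T, f (X i ω) ∂μ = T.card * ∫ x, f x * g x ∂P := by
  classical
  simp_rw [Finset.mul_sum]
  rw [integral_finsetSum]
  · rw [← nsmul_eq_mul, ← Finset.sum_const]
    refine Finset.sum_congr rfl fun i hi => ?_
    have h := integral_finset_prod_comp hX hind hP
      (f := fun k x => if k = i then f x * g x else g x)
      (fun k => by by_cases hk : k = i <;> simp only [hk, if_true, if_false] <;> fun_prop) T
    rw [← Finset.mul_prod_erase T _ hi] at h
    have e : ∀ ω, (∏ k ∈ T, g (X k ω)) * f (X i ω) =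
        ∏ k ∈ T, if k = i then f (X k ω) * g (X k ω) else g (X k ω) := fun ω => by
      rw [← Finset.mul_prod_erase T _ hi, ← Finset.mul_prod_erase T _ hi, if_pos rfl,
        Finset.prod_congr rfl (fun k hk => if_neg (Finset.ne_of_mem_erase hk))]
      ring
    simp_rw [e, h]
    rw [Finset.prod_eq_one, mul_one]
    · simp
    · intro k hk
      simp [Finset.ne_of_mem_erase hk, hg1]
  · intro i _
    refine Integrable.of_bound (by fun_prop) ((∏ _i ∈ T, B) * B) (ae_of_all _ fun ω => ?_)
    rw [norm_mul, norm_prod]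
    exact mul_le_mul (Finset.prod_le_prod (fun _ _ => norm_nonneg _) fun _ _ => hgB _) (hfB _)
      (norm_nonneg _) (Finset.prod_nonneg fun _ _ => (abs_nonneg _).trans (hfB (X i ω)))

end Independence

/-! ### Indicators and separated centres -/

lemma measurable_ind {𝒳 : Type u} [MeasurableSpace 𝒳] {C : Set 𝒳} (hC : MeasurableSet C) :
    Measurable (ind C) :=
  measurable_const.indicator hC

lemma ind_eq_zero_or_one {𝒳 : Type u} (C : Set 𝒳) (x : 𝒳) : ind C x = 0 ∨ ind C x = 1 := by
  by_cases hx : x ∈ C <;> simp [ind, hx]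

lemma ind_nonneg {𝒳 : Type u} (C : Set 𝒳) (x : 𝒳) : 0 ≤ ind C x := by
  rcases ind_eq_zero_or_one C x with h | h <;> simp [h]

lemma ind_le_one {𝒳 : Type u} (C : Set 𝒳) (x : 𝒳) : ind C x ≤ 1 := by
  rcases ind_eq_zero_or_one C x with h | h <;> simp [h]

lemma integral_ind {𝒳 : Type u} [MeasurableSpace 𝒳] (P : Measure 𝒳) {C : Set 𝒳}
    (hC : MeasurableSet C) : ∫ x, ind C x ∂P = P.real C := by
  simpa [ind] using integral_indicator_const (μ := P) (1 : ℝ) hC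

lemma integrable_of_measurable_of_abs_le {𝒳 : Type u} [MeasurableSpace 𝒳] {P : Measure 𝒳}
    [IsFiniteMeasure P] {f : 𝒳 → ℝ} (hf : Measurable f) {B : ℝ} (hB : ∀ x, |f x| ≤ B) :
    Integrable f P :=
  Integrable.of_bound hf.aestronglyMeasurable B (ae_of_all _ hB)

lemma integrable_ind {𝒳 : Type u} [MeasurableSpace 𝒳] {P : Measure 𝒳} [IsFiniteMeasure P]
    {C : Set 𝒳} (hC : MeasurableSet C) : Integrable (ind C) P :=
  integrable_of_measurable_of_abs_le (measurable_ind hC) (B := 1) fun x => by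
    rw [abs_of_nonneg (ind_nonneg C x)]; exact ind_le_one C x

/-- Among candidate centres that are `d`-separated, at most one is within `d / 2` of a given
point, so a weighted sum of distances dominates the weights up to one exceptional index. -/
lemma sum_norm_sub_mul_ge {ι E : Type*} [Fintype ι] [NormedAddCommGroup E] (w : E) (θ : ι → E)
    (ρ : ι → ℝ) (hρ : ∀ j, 0 ≤ ρ j) {d a : ℝ} (hd : 0 ≤ d) (ha : 0 < a)
    (hsep : ∀ j l, j ≠ l → d ≤ ‖θ j - θ l‖) :
    d / 2 * ((∑ j, (ρ j - a * ρ j ^ 2)) - 1 / (4 * a)) ≤ ∑ j, ‖w - θ j‖ * ρ j := by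
  classical
  have hgood : ∀ j, d / 2 ≤ ‖w - θ j‖ → d / 2 * (ρ j - a * ρ j ^ 2) ≤ ‖w - θ j‖ * ρ j := by
    intro j hj
    have h1 : d / 2 * (ρ j - a * ρ j ^ 2) ≤ d / 2 * ρ j :=
      mul_le_mul_of_nonneg_left (by nlinarith [sq_nonneg (ρ j)]) (by linarith)
    exact h1.trans (mul_le_mul_of_nonneg_right hj (hρ j))
  have hpos : 0 ≤ 1 / (4 * a) := by positivity
  by_cases hall : ∀ j, d / 2 ≤ ‖w - θ j‖
  · rw [mul_sub, Finset.mul_sum]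
    have := Finset.sum_le_sum fun j (_ : j ∈ Finset.univ) => hgood j (hall j)
    have h2 : 0 ≤ d / 2 * (1 / (4 * a)) := mul_nonneg (by linarith) hpos
    linarith
  · push Not at hall
    obtain ⟨k, hk⟩ := hall
    have hothers : ∀ j ∈ Finset.univ.erase k, d / 2 * (ρ j - a * ρ j ^ 2) ≤ ‖w - θ j‖ * ρ j := by
      intro j hj
      refine hgood j ?_
      have h1 := hsep j k (Finset.ne_of_mem_erase hj)
      have h2 : ‖θ j - θ k‖ ≤ ‖w - θ j‖ + ‖w - θ k‖ := by
        rw [norm_sub_rev w (θ j)]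
        simpa using norm_add_le (θ j - w) (w - θ k)
      linarith
    -- The distance to the exceptional centre may vanish. The quadratic penalty caps its lost
    -- weight: r - a r² peaks at 1/(4a).
    have hbad : ρ k - a * ρ k ^ 2 ≤ 1 / (4 * a) := by
      rw [le_div_iff₀ (by positivity)]
      nlinarith [sq_nonneg (2 * a * ρ k - 1)]
    have hbad' := mul_le_mul_of_nonneg_left hbad (by linarith : (0 : ℝ) ≤ d / 2)
    have hs := Finset.sum_le_sum hothers
    rw [mul_sub, Finset.mul_sum, ← Finset.add_sum_erase _ _ (Finset.mem_univ k),
      ← Finset.add_sum_erase _ _ (Finset.mem_univ k)]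
    have h3 : 0 ≤ ‖w - θ k‖ * ρ k := mul_nonneg (norm_nonneg _) (hρ k)
    linarith

/-- Complementation pairs `I` with `Iᶜ`, whose cardinals add up to `n`. -/
lemma two_mul_sum_card_compl (n : ℕ) :
    2 * ∑ I : Finset (Fin n), ((Iᶜ.card : ℕ) : ℝ) = 2 ^ n * n := by
  have h1 : ∑ I : Finset (Fin n), ((Iᶜ.card : ℕ) : ℝ) = ∑ I : Finset (Fin n), (I.card : ℝ) :=
    Fintype.sum_equiv (Equiv.ofBijective compl compl_bijective) _ _ fun I => rfl
  rw [two_mul]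
  nth_rw 2 [h1]
  rw [← Finset.sum_add_distrib, Finset.sum_congr rfl (fun I _ => ?_), Finset.sum_const]
  rotate_left
  · exact (n : ℝ)
  · have := Finset.card_compl_add_card I
    rw [Fintype.card_fin] at this
    exact_mod_cast this
  · simp

/-! ### Tilts by centred indicators -/

section LowerBound

variable {Ω : Type v} [MeasurableSpace Ω] {μ : Measure Ω} [IsProbabilityMeasure μ]
  {𝒳 : Type u} [MeasurableSpace 𝒳] {P : Measure 𝒳} [IsProbabilityMeasure P] {n : ℕ}
  {X : Fin n → Ω → 𝒳} {ι : Type*} [Fintype ι]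

/-- The vector of indicators of a finite family of sets. -/
noncomputable def indVec (C : ι → Set 𝒳) (x : 𝒳) : ι → ℝ := fun l => ind (C l) x

/-- The centred indicator of a set. -/
noncomputable def centredInd (P : Measure 𝒳) (C : Set 𝒳) (x : 𝒳) : ℝ := ind C x - P.real C

lemma measurable_indVec {𝒳 : Type u} [MeasurableSpace 𝒳] {ι : Type*} {C : ι → Set 𝒳}
    (hC : ∀ l, MeasurableSet (C l)) :
    Measurable (indVec C) :=
  measurable_pi_iff.2 fun l => measurable_ind (hC l)

lemma norm_indVec_le {𝒳 : Type u} {ι : Type*} [Fintype ι] (C : ι → Set 𝒳) (x : 𝒳)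
    : ‖indVec C x‖ ≤ 1 :=
  (pi_norm_le_iff_of_nonneg zero_le_one).2 fun l => by
    rw [indVec, Real.norm_of_nonneg (ind_nonneg _ _)]; exact ind_le_one _ _

lemma measurable_centredInd {𝒳 : Type u} [MeasurableSpace 𝒳] {P : Measure 𝒳} {C : Set 𝒳}
    (hC : MeasurableSet C) : Measurable (centredInd P C) :=
  (measurable_ind hC).sub_const _

lemma abs_centredInd_le (C : Set 𝒳) (x : 𝒳) : |centredInd P C x| ≤ 1 := by
  have h1 := ind_nonneg C x
  have h2 := ind_le_one C x
  have h3 : 0 ≤ P.real C := measureReal_nonneg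
  have h4 : P.real C ≤ 1 := measureReal_le_one
  rw [abs_le, centredInd]
  constructor <;> linarith

lemma integral_centredInd {C : Set 𝒳} (hC : MeasurableSet C) :
    ∫ x, centredInd P C x ∂P = 0 := by
  simp only [centredInd]
  rw [integral_sub (integrable_ind hC) (integrable_const _), integral_ind P hC]
  simp

lemma integrable_centredInd {C : Set 𝒳} (hC : MeasurableSet C) :
    Integrable (centredInd P C) P :=
  integrable_of_measurable_of_abs_le (measurable_centredInd hC) (abs_centredInd_le C)

lemma integral_one_add_mul_centredInd {C : Set 𝒳} (hC : MeasurableSet C) (t : ℝ) :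
    ∫ x, (1 + t * centredInd P C x) ∂P = 1 := by
  rw [integral_add (integrable_const _) ((integrable_centredInd hC).const_mul t),
    integral_const_mul, integral_centredInd hC]
  simp

/-- The variance of an indicator is at most its mean, and 1 + x ≤ exp x. The exponential form
multiplies well over the sample. -/
lemma integral_one_add_mul_centredInd_sq_le {C : Set 𝒳} (hC : MeasurableSet C) (t : ℝ) :
    ∫ x, (1 + t * centredInd P C x) ^ 2 ∂P ≤ Real.exp (t ^ 2 * P.real C) := by
  have h1 : ∀ x, (1 + t * centredInd P C x) ^ 2 =
      (1 + 2 * t * centredInd P C x) +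
        t ^ 2 * ((1 - 2 * P.real C) * ind C x + P.real C ^ 2) := by
    intro x
    have : ind C x ^ 2 = ind C x := by
      rcases ind_eq_zero_or_one C x with h | h <;> simp [h]
    simp only [centredInd]
    linear_combination t ^ 2 * this
  simp_rw [h1]
  have h3 : Integrable (fun x => (1 - 2 * P.real C) * ind C x) P :=
    (integrable_ind hC).const_mul _
  have h4 : Integrable (fun x => (1 - 2 * P.real C) * ind C x + P.real C ^ 2) P :=
    h3.add (integrable_const _)
  rw [integral_add _ (h4.const_mul _), integral_const_mul,
    integral_add h3 (integrable_const _), integral_const_mul, integral_ind P hC,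
    integral_one_add_mul_centredInd hC]
  · have h2 := Real.add_one_le_exp (t ^ 2 * P.real C)
    simp only [integral_const, probReal_univ, one_smul]
    nlinarith [mul_nonneg (sq_nonneg t) (sq_nonneg (P.real C))]
  · exact (integrable_const _).add ((integrable_centredInd hC).const_mul _)

lemma one_add_mul_centredInd_mem {t : ℝ} (ht : |t| ≤ 1) (C : Set 𝒳) (x : 𝒳) :
    0 ≤ 1 + t * centredInd P C x ∧ 1 + t * centredInd P C x ≤ 2 := by
  have h : |t * centredInd P C x| ≤ 1 := by
    rw [abs_mul]
    exact mul_le_one₀ ht (abs_nonneg _) (abs_centredInd_le C x)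
  rw [abs_le] at h
  constructor <;> linarith

/-- The covariance of the indicators of two sets. -/
noncomputable def indCov (P : Measure 𝒳) (C D : Set 𝒳) : ℝ := ∫ x, ind C x * centredInd P D x ∂P

lemma integrable_ind_mul_centredInd {C D : Set 𝒳} (hC : MeasurableSet C) (hD : MeasurableSet D) :
    Integrable (fun x => ind C x * centredInd P D x) P :=
  integrable_of_measurable_of_abs_le (B := 1)
    ((measurable_ind hC).mul (measurable_centredInd hD)) fun x => by
      rw [abs_mul, abs_of_nonneg (ind_nonneg C x)]
      exact mul_le_one₀ (ind_le_one C x) (abs_nonneg _) (abs_centredInd_le D x)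

/-- The double difference is the variance of 1_C - 1_D, that is P(C △ D) - (P(C) - P(D))², and the
square is at most ε² ≤ ε/8. -/
lemma indCov_separated {C D : Set 𝒳} (hC : MeasurableSet C) (hD : MeasurableSet D) {ε : ℝ}
    (hε : ε ≤ 1 / 8) (hε0 : 0 ≤ ε) (hCε : P.real C ≤ ε) (hDε : P.real D ≤ ε)
    (hsep : ε / 4 ≤ ∫ x, |ind C x - ind D x| ∂P) :
    ε / 8 ≤ (indCov P C C - indCov P C D) - (indCov P D C - indCov P D D) := by
  have e : (indCov P C C - indCov P C D) - (indCov P D C - indCov P D D) =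
      ∫ x, |ind C x - ind D x| ∂P - (P.real C - P.real D) ^ 2 := by
    simp only [indCov]
    have hiC : Integrable
        (fun x => ind C x * centredInd P C x - ind C x * centredInd P D x) P :=
      (integrable_ind_mul_centredInd hC hC).sub (integrable_ind_mul_centredInd hC hD)
    have hiD : Integrable
        (fun x => ind D x * centredInd P C x - ind D x * centredInd P D x) P :=
      (integrable_ind_mul_centredInd hD hC).sub (integrable_ind_mul_centredInd hD hD)
    rw [← integral_sub (integrable_ind_mul_centredInd hC hC) (integrable_ind_mul_centredInd hC hD),
      ← integral_sub (integrable_ind_mul_centredInd hD hC) (integrable_ind_mul_centredInd hD hD),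
      ← integral_sub hiC hiD]
    have h1 : ∀ x, ind C x * centredInd P C x - ind C x * centredInd P D x -
        (ind D x * centredInd P C x - ind D x * centredInd P D x) =
        |ind C x - ind D x| - (P.real C - P.real D) * (ind C x - ind D x) := by
      intro x
      simp only [centredInd]
      rcases ind_eq_zero_or_one C x with h | h <;> rcases ind_eq_zero_or_one D x with h' | h' <;>
        rw [h, h'] <;> norm_num <;> ring
    simp_rw [h1]
    have hi : Integrable (fun x => ind C x - ind D x) P :=
      (integrable_ind hC).sub (integrable_ind hD)
    have h2 : ∫ x, (ind C x - ind D x) ∂P = P.real C - P.real D := by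
      rw [integral_sub (integrable_ind hC) (integrable_ind hD), integral_ind P hC,
        integral_ind P hD]
    rw [integral_sub hi.abs (hi.const_mul _), integral_const_mul]
    rw [h2]
    ring
  have h1 : 0 ≤ P.real C := measureReal_nonneg
  have h2 : 0 ≤ P.real D := measureReal_nonneg
  have h3 : (P.real C - P.real D) ^ 2 ≤ ε ^ 2 := by
    apply sq_le_sq'  <;> linarith
  rw [e]
  nlinarith

end LowerBound

/-! ### Lower bound over a finite separated family -/

section LowerBound

variable {Ω : Type v} [MeasurableSpace Ω] {μ : Measure Ω} [IsProbabilityMeasure μ]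
  {𝒳 : Type u} [MeasurableSpace 𝒳] {P : Measure 𝒳} [IsProbabilityMeasure P] {n : ℕ}
  {X : Fin n → Ω → 𝒳} {ι : Type*} [Fintype ι]

/-- Product tilts `∏ (1 + t h(X_i))` of an i.i.d. sample lie in `[0, 2 ^ n]`. -/
lemma prod_tilt_mem {t : ℝ} (ht : |t| ≤ 1) (D : Set 𝒳) (x : Fin n → 𝒳) (T : Finset (Fin n)) :
    0 ≤ ∏ i ∈ T, (1 + t * centredInd P D (x i)) ∧
      ∏ i ∈ T, (1 + t * centredInd P D (x i)) ≤ 2 ^ n := by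
  have h := fun i => one_add_mul_centredInd_mem (P := P) ht D (x i)
  refine ⟨Finset.prod_nonneg fun i _ => (h i).1, ?_⟩
  calc ∏ i ∈ T, (1 + t * centredInd P D (x i)) ≤ ∏ _i ∈ T, (2 : ℝ) :=
        Finset.prod_le_prod (fun i _ => (h i).1) fun i _ => (h i).2
    _ = 2 ^ T.card := by simp
    _ ≤ 2 ^ n := pow_le_pow_right₀ one_le_two (by simpa using Finset.card_le_univ T)

lemma norm_sum_indVec_le {𝒳 : Type u} {n : ℕ} {ι : Type*} [Fintype ι] (C : ι → Set 𝒳)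
    (x : Fin n → 𝒳) (T : Finset (Fin n)) :
    ‖∑ i ∈ T, indVec C (x i)‖ ≤ n := by
  refine (norm_sum_le _ _).trans ((Finset.sum_le_sum fun i _ => norm_indVec_le C (x i)).trans ?_)
  simp only [Finset.sum_const, nsmul_eq_mul, mul_one]
  exact_mod_cast (by simpa using Finset.card_le_univ T)

/-- Tilting towards `D` shifts the mean of each indicator by `t` times its covariance with 1_D. This
shift is what separates the centres for different `D`. -/
lemma integral_tilt_smul_sum_indVec (hX : ∀ i, Measurable (X i)) (hind : iIndepFun X μ)
    (hP : ∀ i, μ.map (X i) = P) {C : ι → Set 𝒳} (hC : ∀ l, MeasurableSet (C l))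
    {D : Set 𝒳} (hD : MeasurableSet D) {t : ℝ} (ht : |t| ≤ 1) (T : Finset (Fin n)) :
    ∫ ω, (∏ i ∈ T, (1 + t * centredInd P D (X i ω))) • ∑ i ∈ T, indVec C (X i ω) ∂μ =
      fun l => T.card * (P.real (C l) + t * indCov P (C l) D) := by
  have hmt : Measurable (fun x => 1 + t * centredInd P D x) :=
    ((measurable_centredInd hD).const_mul t).const_add 1
  have hmv := measurable_indVec hC
  have hmR : Measurable fun ω => ∏ i ∈ T, (1 + t * centredInd P D (X i ω)) :=
    Finset.measurable_fun_prod _ fun i _ => hmt.comp (hX i)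
  have hmY : Measurable fun ω => ∑ i ∈ T, indVec C (X i ω) :=
    Finset.measurable_fun_sum _ fun i _ => hmv.comp (hX i)
  funext l
  rw [eval_integral]
  · have h := integral_sum_mul_prod_comp hX hind hP (measurable_ind (hC l)) hmt (B := 2)
      (fun x => by
        rw [abs_of_nonneg (ind_nonneg _ _)]; exact (ind_le_one _ _).trans one_le_two)
      (fun x => by
        have := one_add_mul_centredInd_mem (P := P) ht D x
        rw [abs_of_nonneg this.1]; exact this.2)
      (integral_one_add_mul_centredInd hD t) T
    have e : ∫ x, ind (C l) x * (1 + t * centredInd P D x) ∂P =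
        P.real (C l) + t * indCov P (C l) D := by
      have h1 : ∀ x, ind (C l) x * (1 + t * centredInd P D x) =
          ind (C l) x + t * (ind (C l) x * centredInd P D x) := fun x => by ring
      simp_rw [h1]
      rw [integral_add (integrable_ind (hC l))
        ((integrable_ind_mul_centredInd (hC l) hD).const_mul t), integral_const_mul,
        integral_ind P (hC l), indCov]
    rw [e] at h
    rw [← h]
    simp [indVec]
  · intro k
    refine Integrable.of_bound (C := 2 ^ n * n)
      (((measurable_pi_apply k).comp (hmR.smul hmY)).aestronglyMeasurable) ?_
    refine ae_of_all _ fun ω => (norm_le_pi_norm _ k).trans ?_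
    have h := prod_tilt_mem (P := P) ht D (fun i => X i ω) T
    rw [norm_smul, Real.norm_of_nonneg h.1]
    exact mul_le_mul h.2 (norm_sum_indVec_le C (fun i => X i ω) T) (norm_nonneg _) (by positivity)

/-- Partial averaging: conditionally on the part `I` of the sample tilted upwards, the rest of the
sample, tilted downwards, may be replaced by its mean. -/
lemma integral_norm_mul_tilt_le (hX : ∀ i, Measurable (X i)) (hind : iIndepFun X μ)
    (hP : ∀ i, μ.map (X i) = P) {C : ι → Set 𝒳} (hC : ∀ l, MeasurableSet (C l))
    {D : Set 𝒳} (hD : MeasurableSet D) {t : ℝ} (ht : |t| ≤ 1) (I : Finset (Fin n)) :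
    ∫ ω, ‖∑ i ∈ I, indVec C (X i ω) - ((n : ℝ) • (fun l => P.real (C l)) -
        fun l => (Iᶜ.card : ℝ) * (P.real (C l) + -t * indCov P (C l) D))‖ *
          ∏ i ∈ I, (1 + t * centredInd P D (X i ω)) ∂μ ≤
      ∫ ω, ‖∑ i, indVec C (X i ω) - (n : ℝ) • (fun l => P.real (C l))‖ *
        ((∏ i ∈ I, (1 + t * centredInd P D (X i ω))) *
          ∏ i ∈ Iᶜ, (1 + -t * centredInd P D (X i ω))) ∂μ := by
  have ht' : |-t| ≤ 1 := by rwa [abs_neg]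
  have hmt : ∀ t : ℝ, Measurable (fun x => 1 + t * centredInd P D x) := fun t =>
    ((measurable_centredInd hD).const_mul t).const_add 1
  have hmv := measurable_indVec hC
  have hmR : ∀ (t : ℝ) (T : Finset (Fin n)),
      Measurable fun ω => ∏ i ∈ T, (1 + t * centredInd P D (X i ω)) := fun t T =>
    Finset.measurable_fun_prod _ fun i _ => (hmt t).comp (hX i)
  have hmY : ∀ T : Finset (Fin n), Measurable fun ω => ∑ i ∈ T, indVec C (X i ω) := fun T =>
    Finset.measurable_fun_sum _ fun i _ => hmv.comp (hX i)
  have hpi := hind.indepFun_finset I Iᶜ disjoint_compl_right hX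
  set m : ι → ℝ := fun l => P.real (C l) with hm
  have hm1 : ‖m‖ ≤ 1 := (pi_norm_le_iff_of_nonneg zero_le_one).2 fun l => by
    rw [hm, Real.norm_of_nonneg measureReal_nonneg]; exact measureReal_le_one
  have hφ : Measurable fun x : I → 𝒳 =>
      (∑ i : I, indVec C (x i) - (n : ℝ) • m, ∏ i : I, (1 + t * centredInd P D (x i))) := by
    refine Measurable.prodMk ((Finset.measurable_fun_sum _ fun i _ =>
      hmv.comp (measurable_pi_apply i)).sub_const _) (Finset.measurable_fun_prod _ fun i _ =>
        (hmt t).comp (measurable_pi_apply i))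
  have hψ : Measurable fun x : (Iᶜ : Finset (Fin n)) → 𝒳 =>
      (∑ i : (Iᶜ : Finset (Fin n)), indVec C (x i),
        ∏ i : (Iᶜ : Finset (Fin n)), (1 + -t * centredInd P D (x i))) := by
    refine Measurable.prodMk (Finset.measurable_fun_sum _ fun i _ =>
      hmv.comp (measurable_pi_apply i)) (Finset.measurable_fun_prod _ fun i _ =>
        (hmt (-t)).comp (measurable_pi_apply i))
  have hpair := hpi.comp hφ hψ
  have e1 : ((fun x : I → 𝒳 => (∑ i : I, indVec C (x i) - (n : ℝ) • m,
        ∏ i : I, (1 + t * centredInd P D (x i)))) ∘ fun ω (i : I) => X i ω) =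
      fun ω => (∑ i ∈ I, indVec C (X i ω) - (n : ℝ) • m,
        ∏ i ∈ I, (1 + t * centredInd P D (X i ω))) := by
    funext ω
    simp only [Function.comp]
    rw [Finset.sum_coe_sort I (fun i => indVec C (X i ω)),
      Finset.prod_coe_sort I (fun i => 1 + t * centredInd P D (X i ω))]
  have e2 : ((fun x : (Iᶜ : Finset (Fin n)) → 𝒳 => (∑ i : (Iᶜ : Finset (Fin n)), indVec C (x i),
        ∏ i : (Iᶜ : Finset (Fin n)), (1 + -t * centredInd P D (x i)))) ∘
          fun ω (i : (Iᶜ : Finset (Fin n))) => X i ω) =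
      fun ω => (∑ i ∈ Iᶜ, indVec C (X i ω),
        ∏ i ∈ Iᶜ, (1 + -t * centredInd P D (X i ω))) := by
    funext ω
    simp only [Function.comp]
    rw [Finset.sum_coe_sort Iᶜ (fun i => indVec C (X i ω)),
      Finset.prod_coe_sort Iᶜ (fun i => 1 + -t * centredInd P D (X i ω))]
  rw [e1, e2] at hpair
  have hn : (0 : ℝ) ≤ n := Nat.cast_nonneg n
  have h2n : (0 : ℝ) ≤ 2 ^ n := by positivity
  have hR'1 : ∫ ω, ∏ i ∈ Iᶜ, (1 + -t * centredInd P D (X i ω)) ∂μ = 1 := by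
    rw [integral_finset_prod_comp hX hind hP (f := fun _ x => 1 + -t * centredInd P D x)
      fun _ => hmt (-t)]
    exact Finset.prod_eq_one fun i _ => integral_one_add_mul_centredInd hD (-t)
  have main := integral_norm_add_integral_mul_le (μ := μ) (B := 2 * n + 2 ^ n)
    ((hmY I).sub_const _) (hmY Iᶜ) (hmR t I) (hmR (-t) Iᶜ) hpair
    (fun ω => by
      have h1 := norm_sub_le (∑ i ∈ I, indVec C (X i ω)) ((n : ℝ) • m)
      have h2 := norm_sum_indVec_le C (fun i => X i ω) I
      have h3 : ‖(n : ℝ) • m‖ ≤ n := by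
        rw [norm_smul, Real.norm_of_nonneg hn]
        exact mul_le_of_le_one_right hn hm1
      linarith)
    (fun ω => by
      have h2 := norm_sum_indVec_le C (fun i => X i ω) Iᶜ
      linarith)
    (fun ω => (prod_tilt_mem ht D _ I).1) (fun ω => (prod_tilt_mem ht' D _ Iᶜ).1)
    (fun ω => by have := (prod_tilt_mem (P := P) ht D (fun i => X i ω) I).2; linarith)
    (fun ω => by have := (prod_tilt_mem (P := P) ht' D (fun i => X i ω) Iᶜ).2; linarith) hR'1
  rw [integral_tilt_smul_sum_indVec hX hind hP hC hD ht'] at main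
  convert main using 4 with ω ω
  · congr 1
    abel
  · rw [sub_add_eq_add_sub, Finset.sum_add_sum_compl]

/-- Lower bound for the maximal deviation over a finite family of small, well separated sets:
if `4 exp(n δ² ε)` is at most the number of sets then the deviation is at least of order `n δ ε`. -/
theorem le_integral_norm_sum_indVec_sub (hX : ∀ i, Measurable (X i)) (hind : iIndepFun X μ)
    (hP : ∀ i, μ.map (X i) = P) {C : ι → Set 𝒳} (hC : ∀ l, MeasurableSet (C l)) {ε δ : ℝ}
    (hε0 : 0 ≤ ε) (hε : ε ≤ 1 / 8) (hδ0 : 0 ≤ δ) (hδ : δ ≤ 1) (hCε : ∀ l, P.real (C l) ≤ ε)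
    (hsep : ∀ j l, j ≠ l → ε / 4 ≤ ∫ x, |ind (C j) x - ind (C l) x| ∂P)
    (hcard : 4 * Real.exp (n * (δ ^ 2 * ε)) ≤ Fintype.card ι) :
    n * δ * ε / 128 ≤
      ∫ ω, ‖∑ i, indVec C (X i ω) - (n : ℝ) • (fun l => P.real (C l))‖ ∂μ := by
  set F : Ω → ℝ := fun ω => ‖∑ i, indVec C (X i ω) - (n : ℝ) • (fun l => P.real (C l))‖ with hF
  set ρ : Finset (Fin n) → ι → Ω → ℝ :=
    fun I j ω => ∏ i ∈ I, (1 + δ * centredInd P (C j) (X i ω)) with hρ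
  set ρ' : Finset (Fin n) → ι → Ω → ℝ :=
    fun I j ω => ∏ i ∈ I, (1 + -δ * centredInd P (C j) (X i ω)) with hρ'
  -- The full mean minus the tilted mean of the part `Iᶜ`, as produced by
  -- `integral_norm_mul_tilt_le`.
  set θ : Finset (Fin n) → ι → ι → ℝ := fun I j => (n : ℝ) • (fun l => P.real (C l)) -
        fun l => (Iᶜ.card : ℝ) * (P.real (C l) + -δ * indCov P (C l) (C j)) with hθ
  set e : ℝ := Real.exp (n * (δ ^ 2 * ε)) with he
  have he0 : 0 < e := Real.exp_pos _
  set M : ℝ := ((Fintype.card ι : ℕ) : ℝ) with hM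
  have hδabs : |δ| ≤ 1 := by rwa [abs_of_nonneg hδ0]
  have hδabs' : |-δ| ≤ 1 := by rwa [abs_neg]
  have hmt : ∀ (t : ℝ) (j : ι), Measurable (fun x => 1 + t * centredInd P (C j) x) := fun t j =>
    ((measurable_centredInd (hC j)).const_mul t).const_add 1
  have hmv := measurable_indVec hC
  have hmρ : ∀ I j, Measurable (ρ I j) := fun I j =>
    Finset.measurable_fun_prod _ fun i _ => (hmt δ j).comp (hX i)
  have hmρ' : ∀ I j, Measurable (ρ' I j) := fun I j =>
    Finset.measurable_fun_prod _ fun i _ => (hmt (-δ) j).comp (hX i)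
  have hmY : ∀ T : Finset (Fin n), Measurable fun ω => ∑ i ∈ T, indVec C (X i ω) := fun T =>
    Finset.measurable_fun_sum _ fun i _ => hmv.comp (hX i)
  have hmF : Measurable F := ((hmY _).sub_const _).norm
  have hρmem : ∀ I j ω, 0 ≤ ρ I j ω ∧ ρ I j ω ≤ 2 ^ n := fun I j ω =>
    prod_tilt_mem hδabs (C j) (fun i => X i ω) I
  have hρmem' : ∀ I j ω, 0 ≤ ρ' I j ω ∧ ρ' I j ω ≤ 2 ^ n := fun I j ω =>
    prod_tilt_mem hδabs' (C j) (fun i => X i ω) I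
  have hshift : ∀ (T : Finset (Fin n)) (y : ι → ℝ) (ω : Ω),
      ‖∑ i ∈ T, indVec C (X i ω) - y‖ ≤ n + ‖y‖ := fun T y ω =>
    (norm_sub_le _ _).trans (add_le_add (norm_sum_indVec_le C (fun i => X i ω) T) le_rfl)
  have h2n : (0 : ℝ) ≤ 2 ^ n := by positivity
  -- the separation of the centres
  have hθsep : ∀ I j l, j ≠ l → (Iᶜ.card : ℝ) * (δ * ε / 16) ≤ ‖θ I j - θ I l‖ := by
    intro I j l hjl
    have hs := indCov_separated (hC j) (hC l) hε hε0 (hCε j) (hCε l) (hsep j l hjl)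
    have ev : ∀ k, (θ I j - θ I l) k =
        (Iᶜ.card : ℝ) * δ * (indCov P (C k) (C j) - indCov P (C k) (C l)) := fun k => by
      simp only [hθ, Pi.sub_apply]
      ring
    -- Coordinate `j` minus coordinate `l` is `|Iᶜ| δ` times the double difference above, so one of
    -- the two has at least half its size.
    have h1 := norm_le_pi_norm (θ I j - θ I l) j
    have h2 := norm_le_pi_norm (θ I j - θ I l) l
    rw [ev, Real.norm_eq_abs] at h1 h2
    have h1' := (le_abs_self _).trans h1
    have h2' := (neg_le_abs _).trans h2
    have h3 := mul_le_mul_of_nonneg_left hs (mul_nonneg (Nat.cast_nonneg (α := ℝ) Iᶜ.card) hδ0)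
    linarith
  -- moments of the tilts
  have hρint : ∀ I j, Integrable (ρ I j) μ := fun I j =>
    integrable_of_measurable_of_abs_le (hmρ I j) (B := 2 ^ n) fun ω => by
      rw [abs_of_nonneg (hρmem I j ω).1]; exact (hρmem I j ω).2
  have hρ2int : ∀ I j, Integrable (fun ω => ρ I j ω ^ 2) μ := fun I j =>
    integrable_of_measurable_of_abs_le ((hmρ I j).pow_const 2) (B := (2 ^ n) ^ 2) fun ω => by
      rw [abs_of_nonneg (sq_nonneg _)]
      exact pow_le_pow_left₀ (hρmem I j ω).1 (hρmem I j ω).2 2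
  have hρ1 : ∀ I j, ∫ ω, ρ I j ω ∂μ = 1 := fun I j => by
    rw [hρ, integral_finset_prod_comp hX hind hP (f := fun _ x => 1 + δ * centredInd P (C j) x)
      fun _ => hmt δ j]
    exact Finset.prod_eq_one fun i _ => integral_one_add_mul_centredInd (hC j) δ
  have hρ2 : ∀ I j, ∫ ω, ρ I j ω ^ 2 ∂μ ≤ e := fun I j => by
    simp only [hρ, ← Finset.prod_pow]
    rw [integral_finset_prod_comp hX hind hP
      (f := fun _ x => (1 + δ * centredInd P (C j) x) ^ 2) fun _ => (hmt δ j).pow_const 2]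
    have h0 : 0 ≤ δ ^ 2 * ε := by positivity
    calc ∏ _i ∈ I, ∫ x, (1 + δ * centredInd P (C j) x) ^ 2 ∂P
        ≤ ∏ _i ∈ I, Real.exp (δ ^ 2 * ε) := Finset.prod_le_prod
          (fun _ _ => integral_nonneg fun x => sq_nonneg _) fun _ _ =>
            (integral_one_add_mul_centredInd_sq_le (hC j) δ).trans
              (Real.exp_le_exp.2 (mul_le_mul_of_nonneg_left (hCε j) (sq_nonneg _)))
      _ = Real.exp (I.card * (δ ^ 2 * ε)) := by
          rw [Finset.prod_const, ← Real.exp_nat_mul]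
      _ ≤ e := Real.exp_le_exp.2 (mul_le_mul_of_nonneg_right
          (by exact_mod_cast (by simpa using Finset.card_le_univ I)) h0)
  -- the bound for one half-sample
  have hI : ∀ I : Finset (Fin n), (Iᶜ.card : ℝ) * (δ * ε / 16) / 2 * (M / 2) ≤
      ∑ j, ∫ ω, F ω * (ρ I j ω * ρ' Iᶜ j ω) ∂μ := by
    intro I
    have hd : 0 ≤ (Iᶜ.card : ℝ) * (δ * ε / 16) := by positivity
    have hint : ∀ j, Integrable (fun ω => ‖∑ i ∈ I, indVec C (X i ω) - θ I j‖ * ρ I j ω) μ :=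
      fun j => integrable_of_measurable_of_abs_le
        (((hmY I).sub_const _).norm.mul (hmρ I j)) (B := (n + ‖θ I j‖) * 2 ^ n) fun ω => by
          rw [abs_of_nonneg (mul_nonneg (norm_nonneg _) (hρmem I j ω).1)]
          exact mul_le_mul (hshift I _ ω) (hρmem I j ω).2 (hρmem I j ω).1 (by positivity)
    have hint2 : ∀ j, Integrable (fun ω => ρ I j ω - 1 / (4 * e) * ρ I j ω ^ 2) μ := fun j =>
      (hρint I j).sub ((hρ2int I j).const_mul _)
    have hsum : Integrable (fun ω => ∑ j, (ρ I j ω - 1 / (4 * e) * ρ I j ω ^ 2)) μ :=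
      integrable_finsetSum _ fun j _ => hint2 j
    calc (Iᶜ.card : ℝ) * (δ * ε / 16) / 2 * (M / 2)
        ≤ (Iᶜ.card : ℝ) * (δ * ε / 16) / 2 *
          ((∑ j, ∫ ω, (ρ I j ω - 1 / (4 * e) * ρ I j ω ^ 2) ∂μ) - 1 / (4 * (1 / (4 * e)))) := by
          -- With a = 1/(4e) each term has mean at least 1 - 1/4, while the exceptional index costs
          -- 1/(4a) = e ≤ M/4. This leaves M/2.
          refine mul_le_mul_of_nonneg_left ?_ (by linarith)
          have h1 : ∀ j ∈ Finset.univ, (3 / 4 : ℝ) ≤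
              ∫ ω, (ρ I j ω - 1 / (4 * e) * ρ I j ω ^ 2) ∂μ := fun j _ => by
            rw [integral_sub (hρint I j) ((hρ2int I j).const_mul _), integral_const_mul, hρ1]
            have : 1 / (4 * e) * ∫ ω, ρ I j ω ^ 2 ∂μ ≤ 1 / (4 * e) * e :=
              mul_le_mul_of_nonneg_left (hρ2 I j) (by positivity)
            have h4 : 1 / (4 * e) * e = 1 / 4 := by field_simp
            linarith
          have h2 := Finset.sum_le_sum h1
          have h5 : 1 / (4 * (1 / (4 * e))) = e := by field_simp
          rw [h5]
          simp only [Finset.sum_const, Finset.card_univ, nsmul_eq_mul] at h2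
          linarith
      _ = ∫ ω, (Iᶜ.card : ℝ) * (δ * ε / 16) / 2 *
          ((∑ j, (ρ I j ω - 1 / (4 * e) * ρ I j ω ^ 2)) - 1 / (4 * (1 / (4 * e)))) ∂μ := by
          rw [integral_const_mul, integral_sub hsum (integrable_const _),
            integral_finsetSum _ fun j _ => hint2 j]
          simp
      _ ≤ ∫ ω, ∑ j, ‖∑ i ∈ I, indVec C (X i ω) - θ I j‖ * ρ I j ω ∂μ :=
          integral_mono ((hsum.sub (integrable_const _)).const_mul _)
            (integrable_finsetSum _ fun j _ => hint j) fun ω =>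
              sum_norm_sub_mul_ge _ (θ I) _ (fun j => (hρmem I j ω).1) hd (by positivity)
                (hθsep I)
      _ = ∑ j, ∫ ω, ‖∑ i ∈ I, indVec C (X i ω) - θ I j‖ * ρ I j ω ∂μ :=
          integral_finsetSum _ fun j _ => hint j
      _ ≤ ∑ j, ∫ ω, F ω * (ρ I j ω * ρ' Iᶜ j ω) ∂μ := Finset.sum_le_sum fun j _ =>
          integral_norm_mul_tilt_le hX hind hP hC (hC j) hδabs I
  -- Expanding ∏ ((1 + δh) + (1 - δh)) = 2ⁿ over subsets shows that summation over `I` undoes the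
  -- tilting.
  have hexp : ∀ j, ∑ I : Finset (Fin n), ∫ ω, F ω * (ρ I j ω * ρ' Iᶜ j ω) ∂μ =
      2 ^ n * ∫ ω, F ω ∂μ := by
    intro j
    rw [← integral_finsetSum, ← integral_const_mul]
    · congr 1 with ω
      rw [← Finset.mul_sum, mul_comm]
      congr 1
      have h := Finset.prod_add (fun i => 1 + δ * centredInd P (C j) (X i ω))
        (fun i => 1 + -δ * centredInd P (C j) (X i ω)) Finset.univ
      simp only [Finset.powerset_univ] at h
      have h1 : ∀ i, (1 + δ * centredInd P (C j) (X i ω)) +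
          (1 + -δ * centredInd P (C j) (X i ω)) = 2 := fun i => by ring
      simp only [h1, Finset.prod_const, Finset.card_univ, Fintype.card_fin] at h
      rw [h]
      exact Finset.sum_congr rfl fun I _ => by rw [Finset.compl_eq_univ_sdiff]
    · intro I _
      refine integrable_of_measurable_of_abs_le (hmF.mul ((hmρ I j).mul (hmρ' Iᶜ j)))
        (B := (n + ‖(n : ℝ) • (fun l => P.real (C l))‖) * (2 ^ n * 2 ^ n)) fun ω => ?_
      have h0 := mul_nonneg (hρmem I j ω).1 (hρmem' Iᶜ j ω).1
      rw [abs_of_nonneg (mul_nonneg (norm_nonneg _) h0)]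
      exact mul_le_mul (hshift _ _ ω)
        (mul_le_mul (hρmem I j ω).2 (hρmem' Iᶜ j ω).2 (hρmem' Iᶜ j ω).1 h2n) h0 (by positivity)
  have htot := Finset.sum_le_sum fun I (_ : I ∈ (Finset.univ : Finset (Finset (Fin n)))) => hI I
  rw [Finset.sum_comm, Finset.sum_congr rfl fun j _ => hexp j, Finset.sum_const, Finset.card_univ,
    nsmul_eq_mul, ← Finset.sum_mul, ← Finset.sum_div, ← Finset.sum_mul] at htot
  have hc := two_mul_sum_card_compl n
  have hMpos : 0 < M := by linarith
  have hpow : (0 : ℝ) < 2 ^ n := by positivity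
  have hfin : 2 ^ n * M * (n * δ * ε / 128) ≤ 2 ^ n * M * ∫ ω, F ω ∂μ := by
    calc 2 ^ n * M * (n * δ * ε / 128) = 2 ^ n * n * (M * δ * ε / 128) := by ring
      _ = (∑ I : Finset (Fin n), ((Iᶜ.card : ℕ) : ℝ)) * (δ * ε / 16) / 2 * (M / 2) := by
          rw [← hc]; ring
      _ ≤ _ := htot
      _ = _ := by ring
  exact le_of_mul_le_mul_left hfin (by positivity)

end LowerBound

/-! ### From entropy to packings, and the lower bound at one scale -/

lemma logE_natCast (k : ℕ) : logE (k : ℕ∞) = ((Real.log (max (Real.exp 1) k) : ℝ) : EReal) := by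
  have h : (0 : ℝ) < max (Real.exp 1) k := lt_max_of_lt_left (Real.exp_pos 1)
  rw [logE, ENat.toENNReal_coe, ← ENNReal.ofReal_natCast, ← ENNReal.ofReal_max,
    ENNReal.log_ofReal, if_neg (not_le.2 h)]

/-- The floor e in the logarithm hides small counts; `1 < H` excludes that case. -/
lemma natCeil_exp_le_of_le_logE {N : ℕ∞} {H : ℝ} (hH : 1 < H) (h : (H : EReal) ≤ logE N) :
    ((⌈Real.exp H⌉₊ : ℕ) : ℕ∞) ≤ N := by
  by_contra hN
  push Not at hN
  lift N to ℕ using ne_top_of_lt hN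
  rw [logE_natCast, EReal.coe_le_coe_iff] at h
  have h1 : (N : ℝ) < Real.exp H := Nat.lt_ceil.1 (by exact_mod_cast hN)
  have h2 : Real.log (max (Real.exp 1) N) < H :=
    (Real.log_lt_iff_lt_exp (lt_max_of_lt_left (Real.exp_pos 1))).2
      (max_lt (Real.exp_lt_exp.2 hH) h1)
  linarith

section Packing

variable {𝒳 : Type u} [MeasurableSpace 𝒳] {P : Measure 𝒳} [IsProbabilityMeasure P]

lemma le_eLpNorm_ind_sub_iff {C D : Set 𝒳} (hC : MeasurableSet C) (hD : MeasurableSet D) {r : ℝ} :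
    ENNReal.ofReal r ≤ eLpNorm (ind C - ind D) 1 P ↔ r ≤ ∫ x, |ind C x - ind D x| ∂P := by
  have hi : Integrable (ind C - ind D) P := (integrable_ind hC).sub (integrable_ind hD)
  rw [eLpNorm_one_eq_lintegral_enorm, ← ofReal_integral_norm_eq_lintegral_enorm hi,
    ENNReal.ofReal_le_ofReal_iff (integral_nonneg fun x => norm_nonneg _)]
  rfl

/-- A covering number is at most the size of some packing. -/
lemma exists_packing {𝒟 : Set (Set 𝒳)} (h𝒟 : ∀ C ∈ 𝒟, MeasurableSet C) {r : ℝ} (hr : 0 < r)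
    (M : ℕ) (hM : (M : ℕ∞) ≤ coveringNumber P r (ind '' 𝒟)) :
    ∃ s : Finset (Set 𝒳), s.card = M ∧ (∀ C ∈ s, C ∈ 𝒟) ∧
      ∀ C ∈ s, ∀ D ∈ s, C ≠ D → r ≤ ∫ x, |ind C x - ind D x| ∂P := by
  classical
  induction M with
  | zero => exact ⟨∅, by simp⟩
  | succ k ih =>
    obtain ⟨s, hsk, hs𝒟, hs⟩ := ih (le_trans (by exact_mod_cast k.le_succ) hM)
    obtain ⟨C, hC, hCs⟩ : ∃ C ∈ 𝒟, ∀ D ∈ s, r ≤ ∫ x, |ind C x - ind D x| ∂P := by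
      -- If no set can be added, the `k` sets already chosen are the centres of a cover.
      by_contra hcon
      push Not at hcon
      have h1 : coveringNumber P r (ind '' 𝒟) ≤ ((s.image ind).card : ℕ∞) := by
        refine iInf₂_le (s.image ind) ⟨?_, ?_⟩
        · intro g hg
          obtain ⟨D, hD, rfl⟩ := Finset.mem_image.1 hg
          exact ⟨D, hs𝒟 D hD, rfl⟩
        · rintro _ ⟨C, hC, rfl⟩
          obtain ⟨D, hD, hlt⟩ := hcon C hC
          refine ⟨ind D, Finset.mem_image_of_mem _ hD, ?_⟩
          rw [← not_le, le_eLpNorm_ind_sub_iff (h𝒟 C hC) (h𝒟 D (hs𝒟 D hD))]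
          exact not_le.2 hlt
      have h2 : ((k + 1 : ℕ) : ℕ∞) ≤ (k : ℕ∞) :=
        hM.trans (h1.trans (by exact_mod_cast hsk ▸ Finset.card_image_le))
      have h3 : k + 1 ≤ k := by exact_mod_cast h2
      omega
    have hCn : C ∉ s := fun hmem => by
      have := hCs C hmem
      simp at this
      linarith
    refine ⟨insert C s, by rw [Finset.card_insert_of_notMem hCn, hsk], ?_, ?_⟩
    · intro D hD
      rcases Finset.mem_insert.1 hD with rfl | hD
      · exact hC
      · exact hs𝒟 D hD
    · intro D hD E hE hne
      rcases Finset.mem_insert.1 hD with h1 | h1 <;> rcases Finset.mem_insert.1 hE with h2 | h2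
      · exact absurd (h1.trans h2.symm) hne
      · rw [h1]; exact hCs E h2
      · rw [h2]; simp_rw [abs_sub_comm (ind D _)]; exact hCs D h1
      · exact hs D h1 E h2 hne

variable {Ω : Type v} [MeasurableSpace Ω] {μ : Measure Ω} [IsProbabilityMeasure μ]
  {n : ℕ} {X : Fin n → Ω → 𝒳}

lemma abs_empG_ind {𝒳 : Type u} [MeasurableSpace 𝒳] {P : Measure 𝒳} {n : ℕ} {C : Set 𝒳}
    (hC : MeasurableSet C) (hn : 1 ≤ n) (x : Fin n → 𝒳) :
    |empG P x (ind C)| = (Real.sqrt n)⁻¹ * |∑ i, ind C (x i) - n * P.real C| := by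
  have hn0 : (0 : ℝ) < n := by exact_mod_cast hn
  have hs : 0 < Real.sqrt n := Real.sqrt_pos.2 hn0
  rw [empG, integral_ind P hC, abs_mul, abs_of_pos hs]
  have h1 : (n : ℝ)⁻¹ * ∑ i, ind C (x i) - P.real C =
      (n : ℝ)⁻¹ * (∑ i, ind C (x i) - n * P.real C) := by field_simp
  rw [h1, abs_mul, abs_of_pos (inv_pos.2 hn0), ← mul_assoc]
  congr 1
  nth_rw 2 [← Real.mul_self_sqrt hn0.le]
  field_simp

lemma expectedSup_mono {𝒳 : Type u} [MeasurableSpace 𝒳] {P : Measure 𝒳} {Ω : Type v}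
    [MeasurableSpace Ω] {μ : Measure Ω} {n : ℕ} {X : Fin n → Ω → 𝒳} {𝒟 𝒟' : Set (Set 𝒳)}
    (h : 𝒟 ⊆ 𝒟') :
    expectedSup P μ X 𝒟 ≤ expectedSup P μ X 𝒟' :=
  lintegral_mono fun _ => biSup_mono h

lemma localClass_mono {𝒳 : Type u} [MeasurableSpace 𝒳] {P : Measure 𝒳} (𝒞 : Set (Set 𝒳)) {σ σ' : ℝ}
    (h : σ ^ 2 ≤ σ' ^ 2) :
    localClass P 𝒞 σ ⊆ localClass P 𝒞 σ' :=
  fun _ hC => ⟨hC.1, hC.2.trans (ENNReal.ofReal_le_ofReal h)⟩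

/-- A packing of ⌈exp H⌉ sets feeds the finite lower bound; since 4 ≤ exp 2, the condition 4 ≤ H
gives 4 exp(H/2) ≤ exp H. -/
lemma le_expectedSup_of_le_logE (hX : ∀ i, Measurable (X i)) (hind : iIndepFun X μ)
    (hP : ∀ i, μ.map (X i) = P) (hn : 1 ≤ n) {𝒞 : Set (Set 𝒳)}
    (h𝒞 : ∀ C ∈ 𝒞, MeasurableSet C) {ε δ H : ℝ} (hε0 : 0 < ε) (hε : ε ≤ 1 / 8) (hδ0 : 0 ≤ δ)
    (hδ : δ ≤ 1) (hH : 4 ≤ H) (hδH : n * (δ ^ 2 * ε) ≤ H / 2)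
    (hlog : (H : EReal) ≤
      logE (coveringNumber P (ε / 4) (ind '' localClass P 𝒞 (Real.sqrt ε)))) :
    ENNReal.ofReal (Real.sqrt n * (δ * ε) / 128) ≤
      expectedSup P μ X (localClass P 𝒞 (Real.sqrt ε)) := by
  have hn0 : (0 : ℝ) < n := by exact_mod_cast hn
  have hs0 : 0 < Real.sqrt n := Real.sqrt_pos.2 hn0
  obtain ⟨s, hsM, hs𝒟, hs⟩ := exists_packing (P := P) (𝒟 := localClass P 𝒞 (Real.sqrt ε))
    (fun C hC => h𝒞 C hC.1) (by positivity : 0 < ε / 4) _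
    (natCeil_exp_le_of_le_logE (by linarith) hlog)
  have hmeas : ∀ l : s, MeasurableSet (l : Set 𝒳) := fun l => h𝒞 _ (hs𝒟 l l.2).1
  have hcard : 4 * Real.exp (n * (δ ^ 2 * ε)) ≤ Fintype.card s := by
    rw [Fintype.card_coe, hsM]
    refine le_trans ?_ (Nat.le_ceil _)
    have h4 : (4 : ℝ) ≤ Real.exp 2 := by
      have h1 := Real.add_one_le_exp 1
      have h2 : Real.exp 2 = Real.exp 1 * Real.exp 1 := by rw [← Real.exp_add]; norm_num
      nlinarith
    calc 4 * Real.exp (n * (δ ^ 2 * ε)) ≤ Real.exp 2 * Real.exp (H / 2) :=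
          mul_le_mul h4 (Real.exp_le_exp.2 hδH) (Real.exp_pos _).le (Real.exp_pos _).le
      _ = Real.exp (2 + H / 2) := (Real.exp_add _ _).symm
      _ ≤ Real.exp H := Real.exp_le_exp.2 (by linarith)
  have main := le_integral_norm_sum_indVec_sub (ι := s) hX hind hP hmeas hε0.le hε hδ0 hδ
    (fun l => by
      have h := (hs𝒟 l l.2).2
      rw [Real.sq_sqrt hε0.le] at h
      exact ENNReal.toReal_le_of_le_ofReal hε0.le h)
    (fun j l hjl => hs j j.2 l l.2 fun h => hjl (Subtype.ext h)) hcard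
  set W : Ω → s → ℝ := fun ω => ∑ i, indVec (fun l : s => (l : Set 𝒳)) (X i ω) -
    (n : ℝ) • (fun l : s => P.real (l : Set 𝒳)) with hW
  have hWm : Measurable W := (Finset.measurable_fun_sum _ fun i _ =>
    (measurable_indVec hmeas).comp (hX i)).sub_const _
  have hWint : Integrable (fun ω => (Real.sqrt n)⁻¹ * ‖W ω‖) μ := by
    refine (integrable_of_measurable_of_abs_le hWm.norm
      (B := n + ‖(n : ℝ) • (fun l : s => P.real (l : Set 𝒳))‖) fun ω => ?_).const_mul _
    rw [abs_of_nonneg (norm_nonneg _)]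
    exact (norm_sub_le _ _).trans (add_le_add (norm_sum_indVec_le _ (fun i => X i ω) _) le_rfl)
  calc ENNReal.ofReal (Real.sqrt n * (δ * ε) / 128)
      ≤ ENNReal.ofReal (∫ ω, (Real.sqrt n)⁻¹ * ‖W ω‖ ∂μ) := by
        refine ENNReal.ofReal_le_ofReal ?_
        rw [integral_const_mul]
        refine le_trans (le_of_eq ?_) (mul_le_mul_of_nonneg_left main (inv_pos.2 hs0).le)
        have : (n : ℝ) = Real.sqrt n * Real.sqrt n := (Real.mul_self_sqrt hn0.le).symm
        rw [eq_inv_mul_iff_mul_eq₀ hs0.ne']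
        nth_rw 3 [this]
        ring
    _ = ∫⁻ ω, ENNReal.ofReal ((Real.sqrt n)⁻¹ * ‖W ω‖) ∂μ :=
        ofReal_integral_eq_lintegral_ofReal hWint
          (ae_of_all _ fun ω => mul_nonneg (inv_pos.2 hs0).le (norm_nonneg _))
    _ ≤ expectedSup P μ X (localClass P 𝒞 (Real.sqrt ε)) := by
        refine lintegral_mono fun ω => ?_
        -- The supremum may be infinite; the negated inequality makes it finite, so that it can be
        -- compared in ℝ.
        by_contra hcon
        push Not at hcon
        set S := ⨆ C ∈ localClass P 𝒞 (Real.sqrt ε),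
          ENNReal.ofReal |empG P (fun i => X i ω) (ind C)| with hS
        have hStop : S ≠ ⊤ := ne_top_of_lt hcon
        have hb : ‖W ω‖ ≤ Real.sqrt n * S.toReal := by
          refine (pi_norm_le_iff_of_nonneg (by positivity)).2 fun l => ?_
          have h1 : ENNReal.ofReal |empG P (fun i => X i ω) (ind (l : Set 𝒳))| ≤ S :=
            le_iSup₂ (f := fun C (_ : C ∈ localClass P 𝒞 (Real.sqrt ε)) =>
              ENNReal.ofReal |empG P (fun i => X i ω) (ind C)|) (l : Set 𝒳) (hs𝒟 l l.2)
          rw [ENNReal.ofReal_le_iff_le_toReal hStop, abs_empG_ind (hmeas l) hn,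
            inv_mul_le_iff₀ hs0] at h1
          simpa [hW, indVec] using h1
        rw [ENNReal.lt_ofReal_iff_toReal_lt hStop] at hcon
        rw [← inv_mul_le_iff₀ hs0] at hb
        linarith

/-- Above the critical scale ε^(-α) ≤ nε. The lower bound uses this when the tilt is capped, the
upper bound to stay in the Bernstein range. -/
lemma rpow_le_sqrt_of_le {n : ℕ} {α ε : ℝ} (hn : 1 ≤ n) (hα : 0 < α)
    (hε : (n : ℝ) ^ (-1 / (α + 1)) ≤ ε) : ε ^ (-(1 + α) / 2) ≤ Real.sqrt n := by
  have hn0 : (0 : ℝ) < n := by exact_mod_cast hn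
  have h2 : ε ^ (-(1 + α) / 2) ≤ ((n : ℝ) ^ (-1 / (α + 1))) ^ (-(1 + α) / 2) :=
    Real.rpow_le_rpow_of_nonpos (by positivity) hε (by linarith)
  rwa [← Real.rpow_mul hn0.le, show -1 / (α + 1) * (-(1 + α) / 2) = 1 / 2 by field_simp; ring,
    ← Real.sqrt_eq_rpow] at h2

/-- Lower bound at the single scale `ε`, above the critical scale `n ^ (-1 / (α + 1))`. -/
lemma le_expectedSup_of_E2 (hX : ∀ i, Measurable (X i)) (hind : iIndepFun X μ)
    (hP : ∀ i, μ.map (X i) = P) (hn : 1 ≤ n) {𝒞 : Set (Set 𝒳)}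
    (h𝒞 : ∀ C ∈ 𝒞, MeasurableSet C) {α L b ε : ℝ} (hα : 0 < α) (hL : 0 < L) (hb : 0 < b)
    (hE2 : E2 P 𝒞 α L) (hεb : b * (n : ℝ) ^ (-1 / (α + 1)) ≤ ε) (hε : ε ≤ 1 / 8)
    (hεL : ε ≤ (4 * L) ^ (-1 / α)) :
    ENNReal.ofReal (min (b ^ ((1 + α) / 2)) (Real.sqrt (2 * L))⁻¹ / 128 * ε ^ ((1 - α) / 2)) ≤
      expectedSup P μ X (localClass P 𝒞 (Real.sqrt ε)) := by
  have hn0 : (0 : ℝ) < n := by exact_mod_cast hn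
  have hs0 : 0 < Real.sqrt n := Real.sqrt_pos.2 hn0
  have hε0 : 0 < ε := lt_of_lt_of_le (by positivity) hεb
  set H : ℝ := L⁻¹ * ε ^ (-α) with hH
  have hH4 : 4 ≤ H := by
    have h1 : ((4 * L) ^ (-1 / α)) ^ (-α) ≤ ε ^ (-α) :=
      Real.rpow_le_rpow_of_nonpos hε0 hεL (by linarith)
    rw [← Real.rpow_mul (by positivity), show -1 / α * -α = 1 by field_simp, Real.rpow_one] at h1
    rw [hH, le_inv_mul_iff₀ hL]
    linarith
  have hH0 : 0 < H := by linarith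
  -- The largest tilt with nδ²ε ≤ H/2, capped at 1 to keep the densities nonnegative.
  set δ : ℝ := min 1 (Real.sqrt (H / (2 * (n * ε)))) with hδ
  have hδ0 : 0 ≤ δ := le_min zero_le_one (Real.sqrt_nonneg _)
  refine le_trans (ENNReal.ofReal_le_ofReal ?_) (le_expectedSup_of_le_logE hX hind hP hn h𝒞 hε0 hε
    hδ0 (min_le_left _ _) hH4 ?_ (hE2 ε hε0 (by linarith)))
  · rw [div_mul_eq_mul_div]
    refine div_le_div_of_nonneg_right ?_ (by norm_num)
    have hpow : 0 < ε ^ ((1 - α) / 2) := Real.rpow_pos_of_pos hε0 _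
    rcases min_choice 1 (Real.sqrt (H / (2 * (n * ε)))) with h | h
    · rw [hδ, h, one_mul]
      have h1 : (n : ℝ) ^ (-1 / (α + 1)) ≤ ε / b := by rw [le_div_iff₀ hb]; linarith
      have h2 := rpow_le_sqrt_of_le hn hα h1
      rw [Real.div_rpow hε0.le hb.le] at h2
      calc _ ≤ b ^ ((1 + α) / 2) * ε ^ ((1 - α) / 2) :=
            mul_le_mul_of_nonneg_right (min_le_left _ _) hpow.le
        _ = ε ^ (-(1 + α) / 2) / b ^ (-(1 + α) / 2) * ε := by
            rw [show (1 - α) / 2 = -(1 + α) / 2 + 1 by ring, Real.rpow_add hε0, Real.rpow_one,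
              neg_div, Real.rpow_neg hb.le]
            field_simp
        _ ≤ Real.sqrt n * ε := mul_le_mul_of_nonneg_right h2 hε0.le
    · rw [hδ, h]
      refine (mul_le_mul_of_nonneg_right (min_le_right _ _) hpow.le).trans (le_of_eq ?_)
      have h1 : ε ^ ((1 - α) / 2) = Real.sqrt (ε ^ (-α) * ε) := by
        rw [Real.sqrt_eq_rpow, ← Real.rpow_add_one hε0.ne', ← Real.rpow_mul hε0.le]
        congr 1
        ring
      have h2 : ∀ x, 0 ≤ x → Real.sqrt x * ε = Real.sqrt (x * ε ^ 2) := fun x hx => by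
        rw [Real.sqrt_mul hx, Real.sqrt_sq hε0.le]
      rw [h1, ← Real.sqrt_inv, ← Real.sqrt_mul (by positivity), h2 _ (by positivity),
        ← Real.sqrt_mul (by positivity)]
      congr 1
      rw [hH]
      field_simp
  · have h1 : δ ^ 2 ≤ H / (2 * (n * ε)) := by
      rw [← Real.sq_sqrt (show 0 ≤ H / (2 * (n * ε)) by positivity)]
      exact pow_le_pow_left₀ hδ0 (min_le_right _ _) 2
    rw [le_div_iff₀ (by positivity)] at h1
    linarith

end Packing

/-! ### Choice of the scale in the lower bound -/

lemma rpow_rate_eq {n : ℕ} {α : ℝ} (hα : 0 < α) :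
    (n : ℝ) ^ ((α - 1) / (2 * (α + 1))) = ((n : ℝ) ^ (-1 / (α + 1))) ^ ((1 - α) / 2) := by
  rw [← Real.rpow_mul (Nat.cast_nonneg n)]
  congr 1
  field_simp
  ring

lemma rpow_eq_sq_rpow {σ : ℝ} (hσ : 0 < σ) (α : ℝ) : σ ^ (1 - α) = (σ ^ 2) ^ ((1 - α) / 2) := by
  rw [← Real.rpow_natCast_mul hσ.le]
  congr 1
  push_cast
  ring

/-- The lower bound for the local empirical process. -/
theorem exists_le_expectedSup {α L c : ℝ} (hα : 0 < α) (hα1 : α ≠ 1) (hL : 0 < L) (hc : 0 < c) :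
    ∃ K : ℝ, 0 < K ∧
      ∀ (𝒳 : Type u) [MeasurableSpace 𝒳] (P : Measure 𝒳) [IsProbabilityMeasure P]
        (𝒞 : Set (Set 𝒳)), (∀ C ∈ 𝒞, MeasurableSet C) →
        ∀ (Ω : Type v) [MeasurableSpace Ω] (μ : Measure Ω) [IsProbabilityMeasure μ]
          (n : ℕ) (X : Fin n → Ω → 𝒳), 1 ≤ n →
          (∀ i, Measurable (X i)) → iIndepFun X μ → (∀ i, μ.map (X i) = P) →
          ∀ σ : ℝ, 0 < σ → c * (n : ℝ) ^ (-1 / (α + 1)) ≤ σ ^ 2 → E2 P 𝒞 α L → σ ≤ 1 →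
            ENNReal.ofReal
                (K * max (σ ^ (1 - α)) ((n : ℝ) ^ ((α - 1) / (2 * (α + 1))))) ≤
              expectedSup P μ X (localClass P 𝒞 σ) := by
  -- For σ ≤ 1 every ε ≤ κσ² meets both smallness conditions of `le_expectedSup_of_E2`, and b = κc
  -- ensures bτ ≤ κσ².
  set κ : ℝ := min (1 / 8) ((4 * L) ^ (-1 / α)) with hκ
  have hκ0 : 0 < κ := lt_min (by norm_num) (by positivity)
  set b : ℝ := κ * c with hb
  have hb0 : 0 < b := mul_pos hκ0 hc
  set k : ℝ := min (b ^ ((1 + α) / 2)) (Real.sqrt (2 * L))⁻¹ / 128 with hk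
  have hk0 : 0 < k := div_pos (lt_min (by positivity) (by positivity)) (by norm_num)
  set s : ℝ := (1 - α) / 2 with hs
  have step : ∀ (𝒳 : Type u) [MeasurableSpace 𝒳] (P : Measure 𝒳) [IsProbabilityMeasure P]
      (𝒞 : Set (Set 𝒳)), (∀ C ∈ 𝒞, MeasurableSet C) →
      ∀ (Ω : Type v) [MeasurableSpace Ω] (μ : Measure Ω) [IsProbabilityMeasure μ]
        (n : ℕ) (X : Fin n → Ω → 𝒳), 1 ≤ n →
        (∀ i, Measurable (X i)) → iIndepFun X μ → (∀ i, μ.map (X i) = P) → E2 P 𝒞 α L →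
        ∀ σ ε r : ℝ, σ ≤ 1 → 0 < σ → b * (n : ℝ) ^ (-1 / (α + 1)) ≤ ε → ε ≤ κ * σ ^ 2 →
          r ≤ k * ε ^ s → ENNReal.ofReal r ≤ expectedSup P μ X (localClass P 𝒞 σ) := by
    intro 𝒳 _ P _ 𝒞 h𝒞 Ω _ μ _ n X hn hX hind hP hE2 σ ε r hσ1 hσ hbε hεσ hr
    have hn0 : (0 : ℝ) < n := by exact_mod_cast hn
    have hε0 : 0 < ε := lt_of_lt_of_le (by positivity) hbε
    have hσ2 : σ ^ 2 ≤ 1 := pow_le_one₀ hσ.le hσ1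
    have hεκ : ε ≤ κ := hεσ.trans (mul_le_of_le_one_right hκ0.le hσ2)
    refine (ENNReal.ofReal_le_ofReal hr).trans ((le_expectedSup_of_E2 hX hind hP hn h𝒞 hα hL hb0
      hE2 hbε (hεκ.trans (min_le_left _ _)) (hεκ.trans (min_le_right _ _))).trans
        (expectedSup_mono (localClass_mono 𝒞 ?_)))
    rw [Real.sq_sqrt hε0.le]
    refine hεσ.trans (mul_le_of_le_one_left (sq_nonneg _) ((min_le_left _ _).trans ?_))
    norm_num
  have hmax : ∀ A u v : ℝ, 0 ≤ A → 0 ≤ u → v ≤ A * u → max u v ≤ (1 + A) * u := fun A u v hA hu h =>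
    max_le (by nlinarith) (by nlinarith)
  -- For α < 1 the largest scale κσ² gives the rate, for α > 1 the smallest scale bτ does.
  rcases lt_or_gt_of_ne hα1 with h1 | h1
  · have hs0 : 0 < s := by rw [hs]; linarith
    have hA : 0 < (c ^ s)⁻¹ := by positivity
    refine ⟨k * κ ^ s / (1 + (c ^ s)⁻¹), by positivity, ?_⟩
    intro 𝒳 _ P _ 𝒞 h𝒞 Ω _ μ _ n X hn hX hind hP σ hσ hcσ hE2 hσ1
    have hn0 : (0 : ℝ) < n := by exact_mod_cast hn
    have hτ : 0 < (n : ℝ) ^ (-1 / (α + 1)) := by positivity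
    refine step 𝒳 P 𝒞 h𝒞 Ω μ n X hn hX hind hP hE2 σ (κ * σ ^ 2) _ hσ1 hσ ?_ le_rfl ?_
    · rw [hb, mul_assoc]
      exact mul_le_mul_of_nonneg_left hcσ hκ0.le
    · rw [rpow_rate_eq hα, rpow_eq_sq_rpow hσ, ← hs]
      have h2 : ((n : ℝ) ^ (-1 / (α + 1))) ^ s ≤ (c ^ s)⁻¹ * (σ ^ 2) ^ s := by
        rw [le_inv_mul_iff₀ (by positivity), ← Real.mul_rpow hc.le hτ.le]
        exact Real.rpow_le_rpow (by positivity) hcσ hs0.le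
      have h3 := hmax _ _ _ hA.le (by positivity) h2
      rw [Real.mul_rpow hκ0.le (sq_nonneg σ)]
      calc _ ≤ k * κ ^ s / (1 + (c ^ s)⁻¹) * ((1 + (c ^ s)⁻¹) * (σ ^ 2) ^ s) :=
            mul_le_mul_of_nonneg_left h3 (by positivity)
        _ = k * (κ ^ s * (σ ^ 2) ^ s) := by field_simp
  · have hs0 : s < 0 := by rw [hs]; linarith
    refine ⟨k * b ^ s / (1 + c ^ s), by positivity, ?_⟩
    intro 𝒳 _ P _ 𝒞 h𝒞 Ω _ μ _ n X hn hX hind hP σ hσ hcσ hE2 hσ1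
    have hn0 : (0 : ℝ) < n := by exact_mod_cast hn
    have hτ : 0 < (n : ℝ) ^ (-1 / (α + 1)) := by positivity
    refine step 𝒳 P 𝒞 h𝒞 Ω μ n X hn hX hind hP hE2 σ (b * (n : ℝ) ^ (-1 / (α + 1))) _ hσ1 hσ
      le_rfl ?_ ?_
    · rw [hb, mul_assoc]
      exact mul_le_mul_of_nonneg_left hcσ hκ0.le
    · rw [rpow_rate_eq hα, rpow_eq_sq_rpow hσ, ← hs]
      have h2 : (σ ^ 2) ^ s ≤ c ^ s * ((n : ℝ) ^ (-1 / (α + 1))) ^ s := by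
        rw [← Real.mul_rpow hc.le hτ.le]
        exact Real.rpow_le_rpow_of_nonpos (by positivity) hcσ hs0.le
      have h3 := hmax _ _ _ (by positivity) (by positivity) h2
      rw [Real.mul_rpow hb0.le hτ.le, max_comm]
      calc _ ≤ k * b ^ s / (1 + c ^ s) * ((1 + c ^ s) * ((n : ℝ) ^ (-1 / (α + 1))) ^ s) :=
            mul_le_mul_of_nonneg_left h3 (by positivity)
        _ = k * (b ^ s * ((n : ℝ) ^ (-1 / (α + 1))) ^ s) := by field_simp

/-! ### Bernstein bound and finite maximal inequality -/

section FiniteMaximal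

variable {𝒳 : Type u} [MeasurableSpace 𝒳] {P : Measure 𝒳} [IsProbabilityMeasure P]

/-- A Bernstein-type bound on the moment generating function of a bounded function. -/
lemma integral_exp_mul_sub_integral_le {g : 𝒳 → ℝ} (hg : Measurable g) (hg1 : ∀ x, |g x| ≤ 1)
    {v t : ℝ} (hv : ∫ x, |g x| ∂P ≤ v) (ht : |t| ≤ 1 / 2) :
    ∫ x, Real.exp (t * (g x - ∫ y, g y ∂P)) ∂P ≤ Real.exp (t ^ 2 * v) := by
  set m := ∫ y, g y ∂P with hm
  have hgi : Integrable g P := integrable_of_measurable_of_abs_le hg hg1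
  have hm1 : |m| ≤ 1 := by
    refine (abs_integral_le_integral_abs).trans ?_
    calc ∫ x, |g x| ∂P ≤ ∫ _, (1 : ℝ) ∂P := integral_mono hgi.abs (integrable_const _) hg1
      _ = 1 := by simp
  have hb : ∀ x, |t * (g x - m)| ≤ 1 := fun x => by
    rw [abs_mul]
    have h1 : |g x - m| ≤ 2 := (abs_sub _ _).trans (by linarith [hg1 x])
    nlinarith [abs_nonneg t, abs_nonneg (g x - m)]
  -- |exp u - 1 - u| ≤ u² for |u| ≤ 1, and g² ≤ |g| lets the L₁ norm stand in for the second moment.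
  have hpt : ∀ x, Real.exp (t * (g x - m)) ≤
      (1 + t * (g x - m)) + t ^ 2 * (|g x| - 2 * m * g x + m ^ 2) := fun x => by
    have h1 := (abs_le.1 (Real.abs_exp_sub_one_sub_id_le (hb x))).2
    have h2 : g x ^ 2 ≤ |g x| := by
      rw [← sq_abs]; nlinarith [abs_nonneg (g x), hg1 x]
    nlinarith [mul_le_mul_of_nonneg_left h2 (sq_nonneg t)]
  have hi1 : Integrable (fun x => 1 + t * (g x - m)) P :=
    (integrable_const _).add ((hgi.sub (integrable_const _)).const_mul t)
  have hi0 : Integrable (fun x => t * (g x - m)) P := (hgi.sub (integrable_const _)).const_mul t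
  have hi2 : Integrable (fun x => |g x| - 2 * m * g x) P := hgi.abs.sub (hgi.const_mul _)
  have hi3 : Integrable (fun x => |g x| - 2 * m * g x + m ^ 2) P := hi2.add (integrable_const _)
  calc ∫ x, Real.exp (t * (g x - m)) ∂P
      ≤ ∫ x, ((1 + t * (g x - m)) + t ^ 2 * (|g x| - 2 * m * g x + m ^ 2)) ∂P := by
        refine integral_mono_of_nonneg (ae_of_all _ fun x => (Real.exp_pos _).le)
          (hi1.add (hi3.const_mul _)) (ae_of_all _ hpt)
    _ = 1 + t ^ 2 * (∫ x, |g x| ∂P - m ^ 2) := by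
        rw [integral_add hi1 (hi3.const_mul _), integral_add (integrable_const _)
          hi0, integral_const_mul, integral_const_mul,
          integral_sub hgi (integrable_const _), integral_add hi2 (integrable_const _),
          integral_sub hgi.abs (hgi.const_mul _), integral_const_mul, ← hm]
        simp only [integral_const, probReal_univ, one_smul]
        ring
    _ ≤ 1 + t ^ 2 * v := by
      nlinarith [sq_nonneg m, sq_nonneg t, mul_nonneg (sq_nonneg t) (sq_nonneg m)]
    _ ≤ Real.exp (t ^ 2 * v) := by linarith [Real.add_one_le_exp (t ^ 2 * v)]

variable {Ω : Type v} [MeasurableSpace Ω] {μ : Measure Ω} [IsProbabilityMeasure μ]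
  {n : ℕ} {X : Fin n → Ω → 𝒳}

lemma empG_eq {𝒳 : Type u} [MeasurableSpace 𝒳] {P : Measure 𝒳} {n : ℕ} (hn : 1 ≤ n) (x : Fin n → 𝒳)
    (f : 𝒳 → ℝ) :
    empG P x f = (Real.sqrt n)⁻¹ * ∑ i, (f (x i) - ∫ y, f y ∂P) := by
  have hn0 : (0 : ℝ) < n := by exact_mod_cast hn
  have hs : 0 < Real.sqrt n := Real.sqrt_pos.2 hn0
  rw [empG, Finset.sum_sub_distrib]
  simp only [Finset.sum_const, Finset.card_univ, Fintype.card_fin, nsmul_eq_mul]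
  have h1 : (n : ℝ) = Real.sqrt n * Real.sqrt n := (Real.mul_self_sqrt hn0.le).symm
  rw [eq_inv_mul_iff_mul_eq₀ hs.ne', ← mul_assoc, ← h1]
  field_simp

lemma measurable_empG {𝒳 : Type u} [MeasurableSpace 𝒳] {P : Measure 𝒳} {Ω : Type v}
    [MeasurableSpace Ω] {n : ℕ} {X : Fin n → Ω → 𝒳} (hX : ∀ i, Measurable (X i)) {f : 𝒳 → ℝ}
    (hf : Measurable f) :
    Measurable fun ω => empG P (fun i => X i ω) f :=
  (((Finset.measurable_fun_sum _ fun i _ => hf.comp (hX i)).const_mul _).sub_const _).const_mul _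

lemma measurable_iSup_empG {𝒳 : Type u} [MeasurableSpace 𝒳] {P : Measure 𝒳} {Ω : Type v}
    [MeasurableSpace Ω] {n : ℕ} {X : Fin n → Ω → 𝒳} (hX : ∀ i, Measurable (X i)) {ι : Type*}
    (T : Finset ι)
    {f : ι → 𝒳 → ℝ} (hf : ∀ j ∈ T, Measurable (f j)) :
    Measurable fun ω => ⨆ j ∈ T, ENNReal.ofReal |empG P (fun i => X i ω) (f j)| :=
  Measurable.biSup (T : Set ι) T.countable_toSet fun j hj =>
    (continuous_abs.measurable.comp (measurable_empG hX (hf j hj))).ennreal_ofReal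

/-- A maximal inequality for finitely many bounded functions. -/
lemma lintegral_iSup_empG_le (hX : ∀ i, Measurable (X i)) (hind : iIndepFun X μ)
    (hP : ∀ i, μ.map (X i) = P) (hn : 1 ≤ n) {ι : Type*} (T : Finset ι) {f : ι → 𝒳 → ℝ}
    (hf : ∀ j ∈ T, Measurable (f j)) (hf1 : ∀ j ∈ T, ∀ x, |f j x| ≤ 1) {v a t : ℝ}
    (hv0 : 0 ≤ v) (ha0 : 0 ≤ a)
    (hv : ∀ j ∈ T, ∫ x, |f j x| ∂P ≤ v) (ht0 : 0 < t) (ht : t ≤ 1 / 2)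
    (hT : (T.card : ℝ) ≤ Real.exp a) :
    ∫⁻ ω, ⨆ j ∈ T, ENNReal.ofReal |empG P (fun i => X i ω) (f j)| ∂μ ≤
      ENNReal.ofReal ((a + 2 + n * (t ^ 2 * v)) / (t * Real.sqrt n)) := by
  have hn0 : (0 : ℝ) < n := by exact_mod_cast hn
  have hs0 : 0 < Real.sqrt n := Real.sqrt_pos.2 hn0
  set S : ι → Ω → ℝ := fun j ω => ∑ i, (f j (X i ω) - ∫ y, f j y ∂P) with hS
  set q : ℝ := n * (t ^ 2 * v) with hq
  have hq0 : 0 ≤ q := by positivity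
  -- A bound for the mean of the sum of all exp(±tS_j).
  set A : ℝ := 2 * Real.exp a * Real.exp q with hA
  have hA0 : 0 < A := by positivity
  have hlogA : Real.log A ≤ 1 + a + q := by
    rw [hA, Real.log_mul (by positivity) (by positivity),
      Real.log_mul (by norm_num) (by positivity),
      Real.log_exp, Real.log_exp]
    linarith [Real.log_le_sub_one_of_pos (show (0 : ℝ) < 2 by norm_num)]
  have hlogA0 : 0 ≤ Real.log A := Real.log_nonneg (by
    have h1 := Real.one_le_exp ha0
    have h2 := Real.one_le_exp hq0
    rw [hA]
    nlinarith)
  have hfun : ∀ j ∈ T, ∀ r : ℝ, Measurable fun x => Real.exp (r * (f j x - ∫ y, f j y ∂P)) :=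
    fun j hj r => (((hf j hj).sub_const _).const_mul r).exp
  have hfb : ∀ j ∈ T, ∀ x, |f j x - ∫ y, f j y ∂P| ≤ 1 + |∫ y, f j y ∂P| := fun j hj x =>
    (abs_sub _ _).trans (add_le_add (hf1 j hj x) le_rfl)
  have hexp : ∀ r : ℝ, |r| ≤ 1 / 2 → r ^ 2 = t ^ 2 → ∀ j ∈ T,
      Integrable (fun ω => Real.exp (r * S j ω)) μ ∧
        ∫ ω, Real.exp (r * S j ω) ∂μ ≤ Real.exp q := by
    intro r hr hrt j hj
    have hSm : Measurable (S j) :=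
      Finset.measurable_fun_sum _ fun i _ => ((hf j hj).comp (hX i)).sub_const _
    refine ⟨integrable_of_measurable_of_abs_le (hSm.const_mul r).exp
      (B := Real.exp (|r| * (n * (1 + |∫ y, f j y ∂P|)))) fun ω => ?_, ?_⟩
    · rw [abs_of_pos (Real.exp_pos _)]
      refine Real.exp_le_exp.2 ((le_abs_self _).trans ?_)
      rw [abs_mul]
      refine mul_le_mul_of_nonneg_left ((Finset.abs_sum_le_sum_abs _ _).trans
        ((Finset.sum_le_sum fun i _ => hfb j hj (X i ω)).trans (le_of_eq ?_))) (abs_nonneg r)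
      rw [Finset.sum_const, Finset.card_univ, Fintype.card_fin, nsmul_eq_mul]
    · have e : ∀ ω, Real.exp (r * S j ω) =
          ∏ i, Real.exp (r * (f j (X i ω) - ∫ y, f j y ∂P)) := fun ω => by
        rw [← Real.exp_sum, ← Finset.mul_sum]
      simp_rw [e]
      rw [integral_finset_prod_comp hX hind hP
        (f := fun _ x => Real.exp (r * (f j x - ∫ y, f j y ∂P))) fun _ => hfun j hj r]
      calc ∏ _i : Fin n, ∫ x, Real.exp (r * (f j x - ∫ y, f j y ∂P)) ∂P
          ≤ ∏ _i : Fin n, Real.exp (r ^ 2 * v) := Finset.prod_le_prod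
            (fun _ _ => integral_nonneg fun x => (Real.exp_pos _).le) fun _ _ =>
              integral_exp_mul_sub_integral_le (hf j hj) (hf1 j hj) (hv j hj) hr
        _ = Real.exp q := by
            rw [Finset.prod_const, Finset.card_univ, Fintype.card_fin, ← Real.exp_nat_mul, hrt]
  have htabs : |t| ≤ 1 / 2 := by rwa [abs_of_pos ht0]
  have hpos := hexp t htabs rfl
  have hneg := hexp (-t) (by rwa [abs_neg]) (neg_sq t)
  set U : Ω → ℝ := fun ω => (t * Real.sqrt n)⁻¹ *
    (Real.log A + A⁻¹ * ∑ j ∈ T, (Real.exp (t * S j ω) + Real.exp (-t * S j ω))) with hU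
  have hpm : ∀ j ∈ T, Integrable (fun ω => Real.exp (t * S j ω) + Real.exp (-t * S j ω)) μ :=
    fun j hj => (hpos j hj).1.add (hneg j hj).1
  have hsumint : Integrable
      (fun ω => ∑ j ∈ T, (Real.exp (t * S j ω) + Real.exp (-t * S j ω))) μ :=
    integrable_finsetSum _ hpm
  have hUint : Integrable U μ :=
    ((integrable_const _).add (hsumint.const_mul _)).const_mul _
  have hsum0 : ∀ ω, 0 ≤ ∑ j ∈ T, (Real.exp (t * S j ω) + Real.exp (-t * S j ω)) := fun ω =>
    Finset.sum_nonneg fun j _ => by positivity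
  have hU0 : ∀ ω, 0 ≤ U ω := fun ω =>
    mul_nonneg (by positivity) (add_nonneg hlogA0 (mul_nonneg (by positivity) (hsum0 ω)))
  calc ∫⁻ ω, ⨆ j ∈ T, ENNReal.ofReal |empG P (fun i => X i ω) (f j)| ∂μ
      ≤ ∫⁻ ω, ENNReal.ofReal (U ω) ∂μ := by
        refine lintegral_mono fun ω => iSup₂_le fun j hj => ENNReal.ofReal_le_ofReal ?_
        rw [empG_eq hn, abs_mul, abs_of_pos (inv_pos.2 hs0), hU]
        simp only [mul_inv]
        rw [mul_comm t⁻¹, mul_assoc]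
        refine mul_le_mul_of_nonneg_left ?_ (inv_pos.2 hs0).le
        rw [← mul_comm (_ + _), ← div_eq_mul_inv, le_div_iff₀ ht0]
        change |S j ω| * t ≤ _
        have h1 : Real.exp (t * |S j ω|) ≤ Real.exp (t * S j ω) + Real.exp (-t * S j ω) := by
          rcases abs_choice (S j ω) with h | h <;> rw [h]
          · linarith [Real.exp_pos (-t * S j ω)]
          · rw [mul_neg, ← neg_mul]; linarith [Real.exp_pos (t * S j ω)]
        have h2 : Real.exp (t * S j ω) + Real.exp (-t * S j ω) ≤
            ∑ j ∈ T, (Real.exp (t * S j ω) + Real.exp (-t * S j ω)) :=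
          Finset.single_le_sum (f := fun j => Real.exp (t * S j ω) + Real.exp (-t * S j ω))
            (fun j _ => by positivity) hj
        -- The tangent to the exponential at log A takes the place of Jensen's inequality for the
        -- logarithm.
        have h3 : t * |S j ω| - Real.log A + 1 ≤ A⁻¹ * Real.exp (t * |S j ω|) := by
          have := Real.add_one_le_exp (t * |S j ω| - Real.log A)
          rwa [Real.exp_sub, Real.exp_log hA0, div_eq_inv_mul] at this
        have h4 := mul_le_mul_of_nonneg_left (h1.trans h2) (inv_pos.2 hA0).le
        linarith
    _ = ENNReal.ofReal (∫ ω, U ω ∂μ) :=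
        (ofReal_integral_eq_lintegral_ofReal hUint (ae_of_all _ hU0)).symm
    _ ≤ _ := by
        refine ENNReal.ofReal_le_ofReal ?_
        rw [hU, integral_const_mul, integral_add (integrable_const _) (hsumint.const_mul _),
          integral_const_mul, integral_finsetSum _ hpm,
          div_eq_inv_mul]
        refine mul_le_mul_of_nonneg_left ?_ (by positivity)
        have h1 : ∑ j ∈ T, ∫ ω, (Real.exp (t * S j ω) + Real.exp (-t * S j ω)) ∂μ ≤ A := by
          calc ∑ j ∈ T, ∫ ω, (Real.exp (t * S j ω) + Real.exp (-t * S j ω)) ∂μ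
              ≤ ∑ _j ∈ T, 2 * Real.exp q := Finset.sum_le_sum fun j hj => by
                rw [integral_add (hpos j hj).1 (hneg j hj).1]
                linarith [(hpos j hj).2, (hneg j hj).2]
            _ = T.card * (2 * Real.exp q) := by rw [Finset.sum_const, nsmul_eq_mul]
            _ ≤ Real.exp a * (2 * Real.exp q) := mul_le_mul_of_nonneg_right hT (by positivity)
            _ = A := by rw [hA]; ring
        have h2 := mul_le_mul_of_nonneg_left h1 (inv_pos.2 hA0).le
        rw [inv_mul_cancel₀ hA0.ne'] at h2
        simp only [integral_const, probReal_univ, one_smul]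
        linarith

/-- The finite maximal inequality at scale `ε` above the critical scale. -/
lemma lintegral_iSup_empG_le_rpow (hX : ∀ i, Measurable (X i)) (hind : iIndepFun X μ)
    (hP : ∀ i, μ.map (X i) = P) (hn : 1 ≤ n) {ι : Type*} (T : Finset ι) {f : ι → 𝒳 → ℝ}
    (hf : ∀ j ∈ T, Measurable (f j)) (hf1 : ∀ j ∈ T, ∀ x, |f j x| ≤ 1) {α L ε : ℝ} (hα : 0 < α)
    (hε : (n : ℝ) ^ (-1 / (α + 1)) ≤ ε) (hLε : 1 ≤ L * ε ^ (-α))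
    (hv : ∀ j ∈ T, ∫ x, |f j x| ∂P ≤ 3 * ε) (hT : (T.card : ℝ) ≤ Real.exp (2 * (L * ε ^ (-α)))) :
    ∫⁻ ω, ⨆ j ∈ T, ENNReal.ofReal |empG P (fun i => X i ω) (f j)| ∂μ ≤
      ENNReal.ofReal ((8 * L + 2) * ε ^ ((1 - α) / 2)) := by
  have hn0 : (0 : ℝ) < n := by exact_mod_cast hn
  have hs0 : 0 < Real.sqrt n := Real.sqrt_pos.2 hn0
  have hε0 : 0 < ε := lt_of_lt_of_le (by positivity) hε
  set w : ℝ := ε ^ (-(1 + α) / 2) with hw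
  have hw0 : 0 < w := Real.rpow_pos_of_pos hε0 _
  have hwn : w ≤ Real.sqrt n := rpow_le_sqrt_of_le hn hα hε
  -- This `t` makes n t² ε of the order of the entropy ε^(-α); `t ≤ 1 / 2` amounts to `w ≤ √n`.
  refine (lintegral_iSup_empG_le hX hind hP hn T hf hf1 (t := w / (2 * Real.sqrt n))
    (by positivity) (by linarith) hv (by positivity) ?_ hT).trans (ENNReal.ofReal_le_ofReal ?_)
  · rw [div_le_iff₀ (by positivity)]; linarith
  · have e1 : w / (2 * Real.sqrt n) * Real.sqrt n = w / 2 := by field_simp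
    have e2 : n * ((w / (2 * Real.sqrt n)) ^ 2 * (3 * ε)) = 3 / 4 * (w ^ 2 * ε) := by
      rw [div_pow, mul_pow, Real.sq_sqrt hn0.le]
      field_simp
      ring
    have e3 : w ^ 2 * ε = ε ^ (-α) := by
      rw [hw, ← Real.rpow_mul_natCast hε0.le, ← Real.rpow_add_one hε0.ne']
      congr 1
      push_cast
      ring
    have e4 : ε ^ ((1 - α) / 2) = ε ^ (-α) / w := by
      rw [hw, ← Real.rpow_sub hε0]
      congr 1
      ring
    rw [e1, e2, e3, e4, div_le_iff₀ (by positivity)]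
    have h5 : 0 < ε ^ (-α) := Real.rpow_pos_of_pos hε0 _
    have e5 : (8 * L + 2) * (ε ^ (-α) / w) * (w / 2) = (4 * L + 1) * ε ^ (-α) := by
      field_simp
      ring
    rw [e5]
    nlinarith

end FiniteMaximal

/-! ### Clipped brackets -/

section Brackets

variable {𝒳 : Type u}

/-- The lower end of a bracket, clipped to `[0, 1]`. -/
noncomputable def clipLower (p : (𝒳 → ℝ) × (𝒳 → ℝ)) (x : 𝒳) : ℝ := min (max (p.1 x) 0) 1

/-- The upper end of a bracket, clipped to `[0, 1]`. -/
noncomputable def clipUpper (p : (𝒳 → ℝ) × (𝒳 → ℝ)) (x : 𝒳) : ℝ := min (max (p.2 x) 0) 1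

lemma clipLower_mem (p : (𝒳 → ℝ) × (𝒳 → ℝ)) (x : 𝒳) : 0 ≤ clipLower p x ∧ clipLower p x ≤ 1 :=
  ⟨le_min (le_max_right _ _) zero_le_one, min_le_right _ _⟩

lemma clipUpper_mem (p : (𝒳 → ℝ) × (𝒳 → ℝ)) (x : 𝒳) : 0 ≤ clipUpper p x ∧ clipUpper p x ≤ 1 :=
  ⟨le_min (le_max_right _ _) zero_le_one, min_le_right _ _⟩

/-- `p` is a bracket of `1_C`. -/
def Brackets (p : (𝒳 → ℝ) × (𝒳 → ℝ)) (C : Set 𝒳) : Prop := p.1 ≤ ind C ∧ ind C ≤ p.2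

lemma Brackets.clipLower_le {p : (𝒳 → ℝ) × (𝒳 → ℝ)} {C : Set 𝒳} (h : Brackets p C) (x : 𝒳) :
    clipLower p x ≤ ind C x :=
  (min_le_left _ _).trans (max_le (h.1 x) (ind_nonneg C x))

lemma Brackets.le_clipUpper {p : (𝒳 → ℝ) × (𝒳 → ℝ)} {C : Set 𝒳} (h : Brackets p C) (x : 𝒳) :
    ind C x ≤ clipUpper p x :=
  le_min ((h.2 x).trans (le_max_left _ _)) (ind_le_one C x)

/-- The bracket contains a point of [0, 1], so clipping only moves its ends inwards. -/
lemma Brackets.clipUpper_sub_clipLower_le {p : (𝒳 → ℝ) × (𝒳 → ℝ)} {C : Set 𝒳}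
    (h : Brackets p C) (x : 𝒳) : clipUpper p x - clipLower p x ≤ p.2 x - p.1 x := by
  have h1 : p.1 x ≤ ind C x := h.1 x
  have h2 : ind C x ≤ p.2 x := h.2 x
  have h3 := ind_nonneg C x
  have h4 := ind_le_one C x
  have h5 : clipUpper p x ≤ p.2 x := (min_le_left _ _).trans (max_le le_rfl (h3.trans h2))
  have h6 : p.1 x ≤ clipLower p x := le_min (le_max_left _ _) (h1.trans h4)
  linarith

variable [MeasurableSpace 𝒳] {P : Measure 𝒳} [IsProbabilityMeasure P]

/-- `p` is a measurable, integrable pair of functions at `L₁(P)`-distance less than `ε`. -/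
def IsBracketPair (P : Measure 𝒳) (ε : ℝ) (p : (𝒳 → ℝ) × (𝒳 → ℝ)) : Prop :=
  Measurable p.1 ∧ Integrable p.1 P ∧ Measurable p.2 ∧ Integrable p.2 P ∧
    eLpNorm (p.2 - p.1) 1 P < ENNReal.ofReal ε

lemma IsBracketPair.measurable_clipLower {P : Measure 𝒳} {ε : ℝ} {p : (𝒳 → ℝ) × (𝒳 → ℝ)}
    (h : IsBracketPair P ε p) : Measurable (clipLower p) :=
  (h.1.max measurable_const).min measurable_const

lemma IsBracketPair.measurable_clipUpper {P : Measure 𝒳} {ε : ℝ} {p : (𝒳 → ℝ) × (𝒳 → ℝ)}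
    (h : IsBracketPair P ε p) : Measurable (clipUpper p) :=
  (h.2.2.1.max measurable_const).min measurable_const

lemma IsBracketPair.integrable_clipLower {ε : ℝ} {p : (𝒳 → ℝ) × (𝒳 → ℝ)}
    (h : IsBracketPair P ε p) : Integrable (clipLower p) P :=
  integrable_of_measurable_of_abs_le h.measurable_clipLower (B := 1) fun x => by
    rw [abs_of_nonneg (clipLower_mem p x).1]; exact (clipLower_mem p x).2

lemma IsBracketPair.integrable_clipUpper {ε : ℝ} {p : (𝒳 → ℝ) × (𝒳 → ℝ)}
    (h : IsBracketPair P ε p) : Integrable (clipUpper p) P :=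
  integrable_of_measurable_of_abs_le h.measurable_clipUpper (B := 1) fun x => by
    rw [abs_of_nonneg (clipUpper_mem p x).1]; exact (clipUpper_mem p x).2

lemma IsBracketPair.integral_clip_le {ε : ℝ} (hε : 0 ≤ ε) {p : (𝒳 → ℝ) × (𝒳 → ℝ)}
    (h : IsBracketPair P ε p) {C : Set 𝒳} (hC : Brackets p C) :
    ∫ x, (clipUpper p x - clipLower p x) ∂P ≤ ε := by
  have hi : Integrable (p.2 - p.1) P := h.2.2.2.1.sub h.2.1
  have h1 : ∫ x, ‖(p.2 - p.1) x‖ ∂P ≤ ε := by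
    have h2 := h.2.2.2.2.le
    rwa [eLpNorm_one_eq_lintegral_enorm, ← ofReal_integral_norm_eq_lintegral_enorm hi,
      ENNReal.ofReal_le_ofReal_iff hε] at h2
  refine le_trans (integral_mono (h.integrable_clipUpper.sub h.integrable_clipLower) hi.norm
    fun x => ?_) h1
  exact (hC.clipUpper_sub_clipLower_le x).trans (le_abs_self _)

/-- Each lower end is within its own bracket width of the common 1_C, so brackets at successive
levels need not be nested. -/
lemma IsBracketPair.integral_abs_clipLower_sub_le {ε ε' : ℝ} (hε : 0 ≤ ε) (hε' : 0 ≤ ε')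
    {p q : (𝒳 → ℝ) × (𝒳 → ℝ)} (hp : IsBracketPair P ε p) (hq : IsBracketPair P ε' q)
    {C : Set 𝒳} (hpC : Brackets p C) (hqC : Brackets q C) :
    ∫ x, |clipLower q x - clipLower p x| ∂P ≤ ε + ε' := by
  have hip : Integrable (fun x => clipUpper p x - clipLower p x) P :=
    hp.integrable_clipUpper.sub hp.integrable_clipLower
  have hiq : Integrable (fun x => clipUpper q x - clipLower q x) P :=
    hq.integrable_clipUpper.sub hq.integrable_clipLower
  calc ∫ x, |clipLower q x - clipLower p x| ∂P
      ≤ ∫ x, ((clipUpper p x - clipLower p x) + (clipUpper q x - clipLower q x)) ∂P := by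
        refine integral_mono (hq.integrable_clipLower.sub hp.integrable_clipLower).abs
          (hip.add hiq) fun x => ?_
        have h1 := hpC.clipLower_le x
        have h2 := hpC.le_clipUpper x
        have h3 := hqC.clipLower_le x
        have h4 := hqC.le_clipUpper x
        change |clipLower q x - clipLower p x| ≤ _
        rw [abs_le]
        constructor <;> linarith
    _ ≤ ε + ε' := by
        rw [integral_add hip hiq]
        exact add_le_add (hp.integral_clip_le hε hpC) (hq.integral_clip_le hε' hqC)

/-- The bound `1 ≤ L * ε ^ (-α)` comes from the floor e inside the logarithm; it later absorbs
additive constants. -/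
lemma exists_brackets_of_E1 {P : Measure 𝒳} {𝒞 : Set (Set 𝒳)} {α L ε : ℝ} (h : E1 P 𝒞 α L)
    (hε0 : 0 < ε) (hε : ε ≤ 1) :
    1 ≤ L * ε ^ (-α) ∧ ∃ s : Finset ((𝒳 → ℝ) × (𝒳 → ℝ)), (∀ p ∈ s, IsBracketPair P ε p) ∧
      (∀ C ∈ 𝒞, ∃ p ∈ s, Brackets p C) ∧ (s.card : ℝ) ≤ Real.exp (L * ε ^ (-α)) := by
  have h1 := h ε hε0 hε
  set H : ℝ := L * ε ^ (-α) with hH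
  set N := bracketingNumber P ε (ind '' 𝒞) with hN
  have hNtop : N ≠ ⊤ := by
    intro htop
    rw [htop, logE] at h1
    simp at h1
  obtain ⟨k, hk⟩ := ENat.ne_top_iff_exists.1 hNtop
  rw [← hk, logE_natCast, EReal.coe_le_coe_iff,
    Real.log_le_iff_le_exp (lt_max_of_lt_left (Real.exp_pos 1))] at h1
  refine ⟨Real.exp_le_exp.1 ((le_max_left _ _).trans h1), ?_⟩
  have hlt : N < ((k + 1 : ℕ) : ℕ∞) := by rw [← hk]; exact_mod_cast k.lt_succ_self
  rw [hN, bracketingNumber] at hlt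
  obtain ⟨s, hs⟩ := iInf_lt_iff.1 hlt
  obtain ⟨⟨hs1, hs2⟩, hcard⟩ := iInf_lt_iff.1 hs
  refine ⟨s, hs1, fun C hC => hs2 _ ⟨C, hC, rfl⟩, ?_⟩
  have h3 : s.card < k + 1 := by exact_mod_cast hcard
  have h4 : (s.card : ℝ) ≤ k := by exact_mod_cast Nat.lt_succ_iff.1 h3
  exact h4.trans ((le_max_right _ _).trans h1)

end Brackets

/-! ### Chaining along brackets -/

section Chaining

variable {𝒳 : Type u} [MeasurableSpace 𝒳] {P : Measure 𝒳}

lemma empG_sub {n : ℕ} (x : Fin n → 𝒳) {f g : 𝒳 → ℝ} (hf : Integrable f P) (hg : Integrable g P) :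
    empG P x (fun y => f y - g y) = empG P x f - empG P x g := by
  simp only [empG]
  rw [integral_sub hf hg, Finset.sum_sub_distrib]
  ring

/-- Domination of the empirical process at a small nonnegative function by the one at a larger
function, up to the mean of the latter. -/
lemma abs_empG_le_of_le {n : ℕ} (x : Fin n → 𝒳) {f g : 𝒳 → ℝ} (hf : Integrable f P)
    (hg : Integrable g P) (hf0 : ∀ y, 0 ≤ f y) (hfg : ∀ y, f y ≤ g y) :
    |empG P x f| ≤ |empG P x g| + Real.sqrt n * ∫ y, g y ∂P := by
  have h1 : ∫ y, f y ∂P ≤ ∫ y, g y ∂P := integral_mono hf hg hfg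
  have h2 : 0 ≤ ∫ y, f y ∂P := integral_nonneg hf0
  have h3 : (n : ℝ)⁻¹ * ∑ i, f (x i) ≤ (n : ℝ)⁻¹ * ∑ i, g (x i) :=
    mul_le_mul_of_nonneg_left (Finset.sum_le_sum fun i _ => hfg _) (by positivity)
  have h4 : 0 ≤ (n : ℝ)⁻¹ * ∑ i, f (x i) :=
    mul_nonneg (by positivity) (Finset.sum_nonneg fun i _ => hf0 _)
  have hs := Real.sqrt_nonneg n
  rw [abs_le]
  constructor
  · have h5 : -(Real.sqrt n * ∫ y, g y ∂P) ≤ empG P x f := by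
      rw [empG, ← mul_neg]
      exact mul_le_mul_of_nonneg_left (by linarith) hs
    linarith [abs_nonneg (empG P x g)]
  · have h5 : empG P x f ≤ empG P x g + Real.sqrt n * ∫ y, g y ∂P := by
      rw [empG, empG, ← mul_add]
      exact mul_le_mul_of_nonneg_left (by linarith) hs
    linarith [le_abs_self (empG P x g)]

variable [IsProbabilityMeasure P]
  {Ω : Type v} [MeasurableSpace Ω] {μ : Measure Ω} [IsProbabilityMeasure μ]
  {n : ℕ} {X : Fin n → Ω → 𝒳}

/-- The chaining bound over dyadic scales `ε₀ / 2 ^ k`, `k ≤ J`, above the critical scale. -/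
lemma expectedSup_le_chaining (hX : ∀ i, Measurable (X i)) (hind : iIndepFun X μ)
    (hP : ∀ i, μ.map (X i) = P) (hn : 1 ≤ n) {𝒞 𝒟 : Set (Set 𝒳)}
    (h𝒞 : ∀ C ∈ 𝒞, MeasurableSet C) (h𝒟 : 𝒟 ⊆ 𝒞) {α L ε₀ : ℝ} (hα : 0 < α)
    (hE1 : E1 P 𝒞 α L) (hε₀ : 0 < ε₀) (hε₀1 : ε₀ ≤ 1) (h𝒟ε : ∀ C ∈ 𝒟, P.real C ≤ ε₀) (J : ℕ)
    (hJ : (n : ℝ) ^ (-1 / (α + 1)) ≤ ε₀ / 2 ^ J) :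
    expectedSup P μ X 𝒟 ≤
      ENNReal.ofReal ((8 * L + 2) * ε₀ ^ ((1 - α) / 2)) +
      (∑ k ∈ Finset.range J,
        ENNReal.ofReal ((8 * L + 2) * (ε₀ / 2 ^ (k + 1)) ^ ((1 - α) / 2))) +
      (ENNReal.ofReal ((8 * L + 2) * (ε₀ / 2 ^ J) ^ ((1 - α) / 2)) +
        ENNReal.ofReal (Real.sqrt n * (ε₀ / 2 ^ J))) := by
  classical
  set e : ℕ → ℝ := fun k => ε₀ / 2 ^ k with he
  have he0 : ∀ k, 0 < e k := fun k => by positivity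
  have hele : ∀ {k l}, k ≤ l → e l ≤ e k := fun {k l} hkl =>
    div_le_div_of_nonneg_left hε₀.le (by positivity) (pow_le_pow_right₀ one_le_two hkl)
  have hez : e 0 = ε₀ := by simp [he]
  have he1 : ∀ k, e k ≤ 1 := fun k => (hele (Nat.zero_le k)).trans (hez ▸ hε₀1)
  have hes : ∀ k, e k = 2 * e (k + 1) := fun k => by
    simp only [he]
    rw [pow_succ]
    field_simp
  have hcrit : ∀ k ≤ J, (n : ℝ) ^ (-1 / (α + 1)) ≤ e k := fun k hk => hJ.trans (hele hk)
  have hbr := fun k => exists_brackets_of_E1 hE1 (he0 k) (he1 k)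
  choose hL s hs using hbr
  choose hsp hscov hscard using hs
  set H : ℕ → ℝ := fun k => L * e k ^ (-α) with hH
  have hL0 : 0 < L := by
    have h1 := hL 0
    have h2 : 0 < e 0 ^ (-α) := Real.rpow_pos_of_pos (he0 0) _
    by_contra hneg
    nlinarith
  have hHmono : ∀ k, H k ≤ H (k + 1) := fun k => mul_le_mul_of_nonneg_left
    (Real.rpow_le_rpow_of_nonpos (he0 _) (hele k.le_succ) (by linarith)) hL0.le
  -- the finite index sets
  set S : ℕ → Finset ((𝒳 → ℝ) × (𝒳 → ℝ)) := fun k =>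
    (s k).filter fun p => ∃ C ∈ 𝒟, Brackets p C with hS
  -- Both brackets must hold a common set, so their lower ends are within e k + e (k+1) = 3 e (k+1)
  -- of each other in L₁.
  set T : ℕ → Finset (((𝒳 → ℝ) × (𝒳 → ℝ)) × ((𝒳 → ℝ) × (𝒳 → ℝ))) := fun k =>
    (s k ×ˢ s (k + 1)).filter fun p => ∃ C ∈ 𝒟, Brackets p.1 C ∧ Brackets p.2 C with hT
  have hScard : ∀ k, ((S k).card : ℝ) ≤ Real.exp (2 * H k) := fun k => by
    have h1 : ((S k).card : ℝ) ≤ (s k).card := by exact_mod_cast Finset.card_filter_le _ _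
    refine h1.trans ((hscard k).trans (Real.exp_le_exp.2 ?_))
    have : 1 ≤ H k := hL k
    change H k ≤ 2 * H k
    linarith
  have hTcard : ∀ k, ((T k).card : ℝ) ≤ Real.exp (2 * H (k + 1)) := fun k => by
    have h1 : ((T k).card : ℝ) ≤ (s k).card * (s (k + 1)).card := by
      rw [← Nat.cast_mul, ← Finset.card_product]
      exact_mod_cast Finset.card_filter_le _ _
    refine h1.trans ((mul_le_mul (hscard k) (hscard (k + 1)) (Nat.cast_nonneg _)
      (Real.exp_pos _).le).trans ?_)
    rw [← Real.exp_add]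
    refine Real.exp_le_exp.2 ?_
    have := hHmono k
    change H k + H (k + 1) ≤ 2 * H (k + 1)
    linarith
  have hSs : ∀ {k p}, p ∈ S k → IsBracketPair P (e k) p ∧ ∃ C ∈ 𝒟, Brackets p C :=
    fun {k p} hp => ⟨hsp k p (Finset.mem_filter.1 hp).1, (Finset.mem_filter.1 hp).2⟩
  have hTs : ∀ {k p}, p ∈ T k → IsBracketPair P (e k) p.1 ∧ IsBracketPair P (e (k + 1)) p.2 ∧
      ∃ C ∈ 𝒟, Brackets p.1 C ∧ Brackets p.2 C := fun {k p} hp => by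
    obtain ⟨h1, h2⟩ := Finset.mem_filter.1 hp
    exact ⟨hsp k _ (Finset.mem_product.1 h1).1, hsp (k + 1) _ (Finset.mem_product.1 h1).2, h2⟩
  -- the three kinds of maxima
  set A : Ω → ℝ≥0∞ := fun ω =>
    ⨆ p ∈ S 0, ENNReal.ofReal |empG P (fun i => X i ω) (clipLower p)| with hA
  set B : ℕ → Ω → ℝ≥0∞ := fun k ω => ⨆ p ∈ T k, ENNReal.ofReal
    |empG P (fun i => X i ω) (fun y => clipLower p.2 y - clipLower p.1 y)| with hB
  set D : Ω → ℝ≥0∞ := fun ω => ⨆ p ∈ S J, ENNReal.ofReal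
    |empG P (fun i => X i ω) (fun y => clipUpper p y - clipLower p y)| with hD
  have hAm : Measurable A :=
    measurable_iSup_empG hX _ fun p hp => (hSs hp).1.measurable_clipLower
  have hBm : ∀ k, Measurable (B k) := fun k =>
    measurable_iSup_empG hX (T k) (f := fun p y => clipLower p.2 y - clipLower p.1 y) fun p hp =>
      (hTs hp).2.1.measurable_clipLower.sub (hTs hp).1.measurable_clipLower
  have hDm : Measurable D :=
    measurable_iSup_empG hX (S J) (f := fun p y => clipUpper p y - clipLower p y) fun p hp =>
      (hSs hp).1.measurable_clipUpper.sub (hSs hp).1.measurable_clipLower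
  have hAle : ∫⁻ ω, A ω ∂μ ≤ ENNReal.ofReal ((8 * L + 2) * ε₀ ^ ((1 - α) / 2)) := by
    refine lintegral_iSup_empG_le_rpow hX hind hP hn (S 0)
      (fun p hp => (hSs hp).1.measurable_clipLower) (fun p _ x => ?_) hα
      (hez ▸ hcrit 0 (Nat.zero_le J)) (hez ▸ hL 0) (fun p hp => ?_) (hez ▸ hScard 0)
    · rw [abs_of_nonneg (clipLower_mem p x).1]; exact (clipLower_mem p x).2
    · obtain ⟨hp1, C, hC, hpC⟩ := hSs hp
      calc ∫ x, |clipLower p x| ∂P ≤ ∫ x, ind C x ∂P :=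
            integral_mono hp1.integrable_clipLower.abs (integrable_ind (h𝒞 C (h𝒟 hC))) fun x => by
              change |clipLower p x| ≤ _
              rw [abs_of_nonneg (clipLower_mem p x).1]; exact hpC.clipLower_le x
        _ ≤ ε₀ := by rw [integral_ind P (h𝒞 C (h𝒟 hC))]; exact h𝒟ε C hC
        _ ≤ 3 * ε₀ := by linarith
  have hBle : ∀ k ∈ Finset.range J, ∫⁻ ω, B k ω ∂μ ≤
      ENNReal.ofReal ((8 * L + 2) * (ε₀ / 2 ^ (k + 1)) ^ ((1 - α) / 2)) := fun k hk => by
    refine lintegral_iSup_empG_le_rpow hX hind hP hn (T k)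
      (f := fun p y => clipLower p.2 y - clipLower p.1 y) (fun p hp =>
      (hTs hp).2.1.measurable_clipLower.sub (hTs hp).1.measurable_clipLower) (fun p _ x => ?_) hα
      (hcrit (k + 1) (Finset.mem_range.1 hk)) (hL (k + 1)) (fun p hp => ?_) (hTcard k)
    · have h1 := clipLower_mem p.1 x
      have h2 := clipLower_mem p.2 x
      rw [abs_le]
      constructor <;> linarith
    · obtain ⟨hp1, hp2, C, hC, hpC1, hpC2⟩ := hTs hp
      refine (hp1.integral_abs_clipLower_sub_le (he0 k).le (he0 (k + 1)).le hp2 hpC1 hpC2).trans ?_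
      have := hes k
      change e k + e (k + 1) ≤ 3 * e (k + 1)
      linarith
  have hDle : ∫⁻ ω, D ω ∂μ ≤ ENNReal.ofReal ((8 * L + 2) * (ε₀ / 2 ^ J) ^ ((1 - α) / 2)) := by
    refine lintegral_iSup_empG_le_rpow hX hind hP hn (S J)
      (f := fun p y => clipUpper p y - clipLower p y) (fun p hp =>
      (hSs hp).1.measurable_clipUpper.sub (hSs hp).1.measurable_clipLower) (fun p _ x => ?_) hα
      (hcrit J le_rfl) (hL J) (fun p hp => ?_) (hScard J)
    · have h1 := clipLower_mem p x
      have h2 := clipUpper_mem p x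
      rw [abs_le]
      constructor <;> linarith
    · obtain ⟨hp1, C, hC, hpC⟩ := hSs hp
      have h1 : ∀ x, |clipUpper p x - clipLower p x| = clipUpper p x - clipLower p x := fun x =>
        abs_of_nonneg (sub_nonneg.2 ((hpC.clipLower_le x).trans (hpC.le_clipUpper x)))
      simp_rw [h1]
      refine (hp1.integral_clip_le (he0 J).le hpC).trans ?_
      have := he0 J
      change e J ≤ 3 * e J
      linarith
  have hpt : ∀ ω, (⨆ C ∈ 𝒟, ENNReal.ofReal |empG P (fun i => X i ω) (ind C)|) ≤
      A ω + (∑ k ∈ Finset.range J, B k ω) +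
        (D ω + ENNReal.ofReal (Real.sqrt n * (ε₀ / 2 ^ J))) := by
    intro ω
    refine iSup₂_le fun C hC => ?_
    have hsel := fun k => hscov k C (h𝒟 hC)
    choose b hbs hbC using hsel
    have hbS : ∀ k, b k ∈ S k := fun k => Finset.mem_filter.2 ⟨hbs k, C, hC, hbC k⟩
    have hbT : ∀ k, (b k, b (k + 1)) ∈ T k := fun k => Finset.mem_filter.2
      ⟨Finset.mem_product.2 ⟨hbs k, hbs (k + 1)⟩, C, hC, hbC k, hbC (k + 1)⟩
    set x : Fin n → 𝒳 := fun i => X i ω with hx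
    set a : ℕ → ℝ := fun k => empG P x (clipLower (b k)) with ha
    have hli : ∀ k, Integrable (clipLower (b k)) P := fun k => (hSs (hbS k)).1.integrable_clipLower
    have hui : Integrable (clipUpper (b J)) P := (hSs (hbS J)).1.integrable_clipUpper
    have hCi : Integrable (ind C) P := integrable_ind (h𝒞 C (h𝒟 hC))
    have hdecomp : empG P x (ind C) = a 0 + ∑ k ∈ Finset.range J, (a (k + 1) - a k) +
        empG P x (fun y => ind C y - clipLower (b J) y) := by
      rw [Finset.sum_range_sub, empG_sub x hCi (hli J)]
      ring
    -- The remainder ranges over all of 𝒟, but lies between 0 and one of finitely many bracket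
    -- widths; the centring costs √n times the mean width.
    have hlast : |empG P x (fun y => ind C y - clipLower (b J) y)| ≤
        |empG P x (fun y => clipUpper (b J) y - clipLower (b J) y)| +
          Real.sqrt n * (ε₀ / 2 ^ J) := by
      refine (abs_empG_le_of_le x (hCi.sub (hli J)) (hui.sub (hli J))
        (fun y => sub_nonneg.2 ((hbC J).clipLower_le y))
        (fun y => sub_le_sub_right ((hbC J).le_clipUpper y) _)).trans ?_
      exact add_le_add le_rfl (mul_le_mul_of_nonneg_left
        ((hSs (hbS J)).1.integral_clip_le (he0 J).le (hbC J)) (Real.sqrt_nonneg _))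
    have hreal : |empG P x (ind C)| ≤ |a 0| + ∑ k ∈ Finset.range J, |a (k + 1) - a k| +
        (|empG P x (fun y => clipUpper (b J) y - clipLower (b J) y)| +
          Real.sqrt n * (ε₀ / 2 ^ J)) := by
      rw [hdecomp]
      refine (abs_add_le _ _).trans (add_le_add ((abs_add_le _ _).trans
        (add_le_add le_rfl (Finset.abs_sum_le_sum_abs _ _))) hlast)
    refine (ENNReal.ofReal_le_ofReal hreal).trans ?_
    have hsum0 : 0 ≤ ∑ k ∈ Finset.range J, |a (k + 1) - a k| :=
      Finset.sum_nonneg fun k _ => abs_nonneg _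
    rw [ENNReal.ofReal_add (add_nonneg (abs_nonneg _) hsum0) (by positivity),
      ENNReal.ofReal_add (abs_nonneg _) hsum0, ENNReal.ofReal_add (abs_nonneg _) (by positivity),
      ENNReal.ofReal_sum_of_nonneg fun k _ => abs_nonneg _]
    refine add_le_add (add_le_add ?_ (Finset.sum_le_sum fun k _ => ?_)) (add_le_add ?_ le_rfl)
    · exact le_iSup₂ (f := fun p (_ : p ∈ S 0) => ENNReal.ofReal |empG P x (clipLower p)|)
        (b 0) (hbS 0)
    · rw [ha, ← empG_sub x (hli (k + 1)) (hli k)]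
      exact le_iSup₂ (f := fun p (_ : p ∈ T k) => ENNReal.ofReal
        |empG P x (fun y => clipLower p.2 y - clipLower p.1 y)|) (b k, b (k + 1)) (hbT k)
    · exact le_iSup₂ (f := fun p (_ : p ∈ S J) => ENNReal.ofReal
        |empG P x (fun y => clipUpper p y - clipLower p y)|) (b J) (hbS J)
  refine (lintegral_mono hpt).trans ?_
  have hABm : Measurable fun ω => A ω + ∑ k ∈ Finset.range J, B k ω :=
    hAm.add (Finset.measurable_fun_sum _ fun k _ => hBm k)
  rw [lintegral_add_left hABm,
    lintegral_add_left hAm, lintegral_finsetSum _ fun k _ => hBm k,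
    lintegral_add_left hDm, lintegral_const, measure_univ, mul_one]
  exact add_le_add (add_le_add hAle (Finset.sum_le_sum hBle)) (add_le_add hDle le_rfl)

end Chaining

/-! ### Summation over scales and the upper bound -/

lemma sum_range_pow_le {q : ℝ} (hq0 : 0 ≤ q) (hq1 : q < 1) (m : ℕ) :
    ∑ k ∈ Finset.range m, q ^ k ≤ (1 - q)⁻¹ := by
  rw [← tsum_geometric_of_lt_one hq0 hq1]
  exact (summable_geometric_of_lt_one hq0 hq1).sum_le_tsum _ fun k _ => pow_nonneg hq0 k

/-- A geometric series over dyadic scales is dominated by its largest end term. -/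
lemma exists_sum_dyadic_rpow_le {s : ℝ} (hs : s ≠ 0) :
    ∃ A : ℝ, 1 ≤ A ∧ ∀ ε : ℝ, 0 < ε → ∀ J : ℕ,
      ∑ k ∈ Finset.range (J + 1), (ε / 2 ^ k) ^ s ≤ A * max (ε ^ s) ((ε / 2 ^ J) ^ s) := by
  have key : ∀ q : ℝ, 0 < q → q < 1 → 1 ≤ (1 - q)⁻¹ := fun q h0 h1 =>
    (one_le_inv₀ (by linarith)).2 (by linarith)
  rcases lt_or_gt_of_ne hs with h | h
  · have hq0 : 0 < (2 : ℝ) ^ s := by positivity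
    have hq1 : (2 : ℝ) ^ s < 1 := Real.rpow_lt_one_of_one_lt_of_neg one_lt_two h
    refine ⟨(1 - 2 ^ s)⁻¹, key _ hq0 hq1, fun ε hε J => ?_⟩
    -- For s < 0 the terms grow with `k`; counted back from `J` they decay with ratio 2^s.
    have e : ∀ k ∈ Finset.range (J + 1),
        (ε / 2 ^ k) ^ s = (ε / 2 ^ J) ^ s * ((2 : ℝ) ^ s) ^ (J + 1 - 1 - k) := fun k hk => by
      have hk' : k ≤ J := Nat.lt_succ_iff.1 (Finset.mem_range.1 hk)
      rw [Real.rpow_pow_comm zero_le_two, ← Real.mul_rpow (by positivity) (by positivity)]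
      congr 1
      obtain ⟨d, rfl⟩ := Nat.exists_eq_add_of_le hk'
      rw [show k + d + 1 - 1 - k = d by omega, pow_add]
      field_simp
    rw [Finset.sum_congr rfl e, ← Finset.mul_sum,
      Finset.sum_range_reflect (fun k => ((2 : ℝ) ^ s) ^ k) (J + 1), mul_comm]
    exact mul_le_mul (sum_range_pow_le hq0.le hq1 _) (le_max_right _ _) (by positivity)
      (inv_nonneg.2 (by linarith))
  · have hq0 : 0 < (2 : ℝ) ^ (-s) := by positivity
    have hq1 : (2 : ℝ) ^ (-s) < 1 := Real.rpow_lt_one_of_one_lt_of_neg one_lt_two (by linarith)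
    refine ⟨(1 - 2 ^ (-s))⁻¹, key _ hq0 hq1, fun ε hε J => ?_⟩
    have e : ∀ k ∈ Finset.range (J + 1),
        (ε / 2 ^ k) ^ s = ε ^ s * ((2 : ℝ) ^ (-s)) ^ k := fun k _ => by
      rw [Real.rpow_pow_comm zero_le_two, Real.rpow_neg (by positivity), Real.div_rpow hε.le
        (by positivity), div_eq_mul_inv]
    rw [Finset.sum_congr rfl e, ← Finset.mul_sum, mul_comm]
    exact mul_le_mul (sum_range_pow_le hq0.le hq1 _) (le_max_left _ _) (by positivity)
      (inv_nonneg.2 (by linarith))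

/-- The upper bound for the local empirical process. -/
theorem exists_expectedSup_le {α L : ℝ} (hα : 0 < α) (hα1 : α ≠ 1) (hL : 0 < L) :
    ∃ K : ℝ, 0 < K ∧
      ∀ (𝒳 : Type u) [MeasurableSpace 𝒳] (P : Measure 𝒳) [IsProbabilityMeasure P]
        (𝒞 : Set (Set 𝒳)), (∀ C ∈ 𝒞, MeasurableSet C) → E1 P 𝒞 α L →
        ∀ (Ω : Type v) [MeasurableSpace Ω] (μ : Measure Ω) [IsProbabilityMeasure μ]
          (n : ℕ) (X : Fin n → Ω → 𝒳), 1 ≤ n →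
          (∀ i, Measurable (X i)) → iIndepFun X μ → (∀ i, μ.map (X i) = P) →
          ∀ σ : ℝ, 0 < σ →
            expectedSup P μ X (localClass P 𝒞 σ) ≤
              ENNReal.ofReal
                (K * max (σ ^ (1 - α)) ((n : ℝ) ^ ((α - 1) / (2 * (α + 1))))) := by
  set s : ℝ := (1 - α) / 2 with hs
  have hs0 : s ≠ 0 := by
    rw [hs]
    intro h
    exact hα1 (by linarith)
  obtain ⟨A, hA1, hA⟩ := exists_sum_dyadic_rpow_le hs0
  refine ⟨(8 * L + 2) * A + (8 * L + 2) + 2, by positivity, ?_⟩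
  intro 𝒳 _ P _ 𝒞 h𝒞 hE1 Ω _ μ _ n X hn hX hind hP σ hσ
  have hn0 : (0 : ℝ) < n := by exact_mod_cast hn
  set τ : ℝ := (n : ℝ) ^ (-1 / (α + 1)) with hτ
  have hτ0 : 0 < τ := by positivity
  have hτ1 : τ ≤ 1 := Real.rpow_le_one_of_one_le_of_nonpos (by exact_mod_cast hn)
    (div_nonpos_of_nonpos_of_nonneg (by norm_num) (by linarith))
  rw [rpow_rate_eq hα, rpow_eq_sq_rpow hσ, ← hs, ← hτ]
  set R : ℝ := max ((σ ^ 2) ^ s) (τ ^ s) with hR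
  -- The chain starts no lower than τ, and no higher than 1, where (E1) is available.
  set ε₀ : ℝ := min (max (σ ^ 2) τ) 1 with hε₀
  have hτε : τ ≤ ε₀ := le_min (le_max_right _ _) hτ1
  have hε₀0 : 0 < ε₀ := hτ0.trans_le hτε
  -- The last dyadic scale not below τ, hence at most 2τ.
  obtain ⟨J, hJ1, hJ2⟩ := exists_nat_pow_near ((one_le_div hτ0).2 hτε) (one_lt_two (α := ℝ))
  have hpow : (0 : ℝ) < 2 ^ J := by positivity
  have hJτ : τ ≤ ε₀ / 2 ^ J := by
    rw [le_div_iff₀ hτ0] at hJ1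
    rw [le_div_iff₀ hpow]
    linarith
  have hJτ2 : ε₀ / 2 ^ J ≤ 2 * τ := by
    rw [div_lt_iff₀ hτ0, pow_succ] at hJ2
    rw [div_le_iff₀ hpow]
    linarith
  have hεJ0 : 0 < ε₀ / 2 ^ J := by positivity
  have hends : ∀ ε, τ ≤ ε → ε ≤ ε₀ → ε ^ s ≤ R := fun ε h1 h2 => by
    rcases lt_or_gt_of_ne hs0 with h | h
    · exact (Real.rpow_le_rpow_of_nonpos hτ0 h1 h.le).trans (le_max_right _ _)
    · refine (Real.rpow_le_rpow (hτ0.le.trans h1) (h2.trans (min_le_left _ _)) h.le).trans ?_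
      rcases max_choice (σ ^ 2) τ with h' | h' <;> rw [h']
      · exact le_max_left _ _
      · exact le_max_right _ _
  have hεJ : ε₀ / 2 ^ J ≤ ε₀ := div_le_self hε₀0.le (one_le_pow₀ one_le_two)
  have hsqrt : Real.sqrt n * (ε₀ / 2 ^ J) ≤ 2 * R := by
    have h1 : Real.sqrt n * τ = τ ^ s := by
      rw [hτ, Real.sqrt_eq_rpow, ← Real.rpow_add hn0, ← Real.rpow_mul hn0.le, hs]
      congr 1
      field_simp
      ring
    calc Real.sqrt n * (ε₀ / 2 ^ J) ≤ Real.sqrt n * (2 * τ) :=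
          mul_le_mul_of_nonneg_left hJτ2 (Real.sqrt_nonneg _)
      _ = 2 * τ ^ s := by rw [← h1]; ring
      _ ≤ 2 * R := mul_le_mul_of_nonneg_left (le_max_right _ _) zero_le_two
  have hsmall : ∀ C ∈ localClass P 𝒞 σ, P.real C ≤ ε₀ := fun C hC => by
    have h1 : P.real C ≤ σ ^ 2 := ENNReal.toReal_le_of_le_ofReal (sq_nonneg σ) hC.2
    exact le_min (h1.trans (le_max_left _ _)) measureReal_le_one
  refine (expectedSup_le_chaining hX hind hP hn h𝒞 (fun C hC => hC.1) hα hE1 hε₀0 (min_le_right _ _)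
    hsmall J hJτ).trans ?_
  have hnn : ∀ ε : ℝ, 0 < ε → 0 ≤ (8 * L + 2) * ε ^ ((1 - α) / 2) := fun ε hε => by positivity
  rw [← ENNReal.ofReal_sum_of_nonneg fun k _ => hnn _ (by positivity),
    ← ENNReal.ofReal_add (hnn _ hε₀0) (Finset.sum_nonneg fun k _ => hnn _ (by positivity)),
    ← ENNReal.ofReal_add (hnn _ hεJ0) (by positivity),
    ← ENNReal.ofReal_add (add_nonneg (hnn _ hε₀0)
      (Finset.sum_nonneg fun k _ => hnn _ (by positivity)))
      (add_nonneg (hnn _ hεJ0) (by positivity))]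
  refine ENNReal.ofReal_le_ofReal ?_
  rw [← hs, ← Finset.mul_sum, ← mul_add]
  have h1 := hA ε₀ hε₀0 J
  rw [Finset.sum_range_succ', pow_zero, div_one, add_comm] at h1
  have h2 : max (ε₀ ^ s) ((ε₀ / 2 ^ J) ^ s) ≤ R := max_le (hends _ hτε le_rfl) (hends _ hJτ hεJ)
  have hL2 : 0 ≤ 8 * L + 2 := by linarith
  have h3 := mul_le_mul_of_nonneg_left (h1.trans (mul_le_mul_of_nonneg_left h2 (by linarith))) hL2
  have h4 := mul_le_mul_of_nonneg_left (hends _ hJτ hεJ) hL2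
  linarith

end SetEP

/-! ### The two bounds with a common constant -/

theorem theorem2 (α : ℝ) (hα : 0 < α) (hα1 : α ≠ 1) (L : ℝ) (hL : 0 < L)
    (c : ℝ) (hc : 0 < c) :
    ∃ K : ℝ, 0 < K ∧
      ∀ (𝒳 : Type u) [MeasurableSpace 𝒳] (P : Measure 𝒳) [IsProbabilityMeasure P]
        (𝒞 : Set (Set 𝒳)), 𝒞.Countable → (∀ C ∈ 𝒞, MeasurableSet C) →
        SetEP.E1 P 𝒞 α L →
        ∀ (Ω : Type v) [MeasurableSpace Ω] (μ : Measure Ω) [IsProbabilityMeasure μ]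
          (n : ℕ) (X : Fin n → Ω → 𝒳), 1 ≤ n →
          (∀ i, Measurable (X i)) → iIndepFun X μ → (∀ i, μ.map (X i) = P) →
          ∀ σ : ℝ, 0 < σ → c * (n : ℝ) ^ (-1 / (α + 1)) ≤ σ ^ 2 →
            SetEP.expectedSup P μ X (SetEP.localClass P 𝒞 σ) ≤
                ENNReal.ofReal
                  (K * max (σ ^ (1 - α)) ((n : ℝ) ^ ((α - 1) / (2 * (α + 1))))) ∧
              (SetEP.E2 P 𝒞 α L → σ ≤ 1 →
                ENNReal.ofReal
                    (K⁻¹ * max (σ ^ (1 - α)) ((n : ℝ) ^ ((α - 1) / (2 * (α + 1))))) ≤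
                  SetEP.expectedSup P μ X (SetEP.localClass P 𝒞 σ)) := by
  obtain ⟨K₁, hK₁, hupper⟩ := SetEP.exists_expectedSup_le.{u, v} hα hα1 hL
  obtain ⟨K₂, hK₂, hlower⟩ := SetEP.exists_le_expectedSup.{u, v} hα hα1 hL hc
  refine ⟨max K₁ K₂⁻¹, lt_max_of_lt_left hK₁, ?_⟩
  intro 𝒳 _ P _ 𝒞 _ h𝒞 hE1 Ω _ μ _ n X hn hX hind hP σ hσ hcσ
  have hR : 0 ≤ max (σ ^ (1 - α)) ((n : ℝ) ^ ((α - 1) / (2 * (α + 1)))) :=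
    le_max_of_le_left (by positivity)
  refine ⟨(hupper 𝒳 P 𝒞 h𝒞 hE1 Ω μ n X hn hX hind hP σ hσ).trans (ENNReal.ofReal_le_ofReal
    (mul_le_mul_of_nonneg_right (le_max_left _ _) hR)), fun hE2 hσ1 => ?_⟩
  refine (ENNReal.ofReal_le_ofReal (mul_le_mul_of_nonneg_right ?_ hR)).trans
    (hlower 𝒳 P 𝒞 h𝒞 Ω μ n X hn hX hind hP σ hσ hcσ hE2 hσ1)
  exact inv_le_of_inv_le₀ hK₂ (le_max_right _ _)
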